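/- Let $E$ be a simple Euclidean Jordan algebra (a nonzero finite-dimensional Euclidean space with a commutative bilinear product and neutral element $e$, satisfying $x(x^2y)=x^2(xy)$ and $\langle x,yz\rangle=\langle xy,z\rangle$, which is not a product of two such algebras of positive dimension). Let $r$ be its rank, let $\det x$ be the product of the $r$ eigenvalues of $x$ in a spectral decomposition, put $n=\dim E$, and let $\mathcal V$, the interior of $\{x^2 : x\in E\}$, be its irreducible symmetric cone and $\mathcal D=\{x\in\mathcal V : e-x\in\mathcal V\}$. Let $G$ be the connected component of the identity in the group of linear automorphisms of $E$ that preserve $\mathcal V$. A multiplication algorithm is a map $w:\mathcal V\to G$ with $w(x)e=x$ for all $x\in\mathcal V$. A function $f:\mathcal V\to(0,\infty)$ is called $w$-multiplicative if $f(x)\,f(w(e)y)=f(w(x)y)$ for all $x,y\in\mathcal V$. Let $w,\tilde w$ be multiplication algorithms that are differentiable as maps $\mathcal V\to\mathrm{End}(E)$. For random variables $X,Y$ with values in $\mathcal D$ put $$U=e-w(X)Y,\qquad V=\tilde w(U)^{-1}(e-X).$$ (1) Let $i$ be both $w$- and $\tilde w$-multiplicative, $f$ be $\tilde w$-multiplicative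 and $h$ be $w$-multiplicative. If $X$ and $Y$ are independent and have, with respect to Lebesgue measure, densities of the form $$f_X(x)=c_X(\det x)^{n/r}\,i(x)\,h(x)\,f(e-x)\,\mathbf 1_{\mathcal D}(x),\qquad f_Y(x)=c_Y\,h(w(e)x)\,i(e-w(e)x)\,\mathbf 1_{\mathcal D}(x),$$ where $c_X,c_Y$ are normalizing constants, then $U$ and $V$ are independent. (2) Let $\mathcal B(p,q)$ be the beta distribution, with density proportional to $(\det x)^{p-n/r}\det(e-x)^{q-n/r}\,\mathbf 1_{\mathcal D}(x)$, and let $p_1,p_2,p_3>n/r-1$. Then $i(x)=(\det x)^{p_1-n/r}$, $f(x)=(\det x)^{p_2-n/r}$ and $h(x)=(\det x)^{p_3-n/r}$ satisfy the multiplicativity assumptions in (1). If $X,Y$ are independent with the densities in (1) for these $i,f,h$, then $(X,Y)\sim\mathcal B(p_1+p_3,p_2)\otimes\mathcal B(p_3,p_1)$. Moreover, whenever $(X,Y)\sim\mathcal B(p_1+p_3,p_2)\otimes\mathcal B(p_3,p_1)$, one has $(U,V)\sim\mathcal B(p_1+p_2,p_3)\otimes\mathcal B(p_2,p_1)$. This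 holds for all differentiable multiplication algorithms $w$ and $\tilde w$. -/

import Mathlib

open MeasureTheory ProbabilityTheory

open scoped ENNReal InnerProductSpace

/-- A Euclidean Jordan algebra: a Euclidean space (finite dimensionality is asked for separately)
with a bilinear commutative product `x * y` and a neutral element `1`, satisfying the Jordan
identity and associativity of the inner product. -/
class EuclideanJordanAlgebra (E : Type*) [NormedAddCommGroup E] [InnerProductSpace ℝ E]
    extends Mul E, One E where
  mul_add' : ∀ x y z : E, x * (y + z) = x * y + x * z
  mul_smul' : ∀ (t : ℝ) (x y : E), x * (t • y) = t • (x * y)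
  mul_comm' : ∀ x y : E, x * y = y * x
  jordan' : ∀ x y : E, x * ((x * x) * y) = (x * x) * (x * y)
  mul_one' : ∀ x : E, x * 1 = x
  inner_mul' : ∀ x y z : E, ⟪x, y * z⟫_ℝ = ⟪x * y, z⟫_ℝ

noncomputable section

section Algebra

variable (E : Type*) [NormedAddCommGroup E] [InnerProductSpace ℝ E] [EuclideanJordanAlgebra E]

/-- `E` is simple: it is nonzero and is not a Cartesian product `I × J` of two algebras of positive
dimension (the product is expressed internally, with componentwise multiplication). -/
def IsSimpleEJA : Prop :=
  Nontrivial E ∧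
    ∀ I J : Submodule ℝ E, IsCompl I J →
      (∀ x ∈ I, ∀ y ∈ I, x * y ∈ I) → (∀ x ∈ J, ∀ y ∈ J, x * y ∈ J) →
      (∀ x ∈ I, ∀ y ∈ J, x * y = 0) → I = ⊥ ∨ J = ⊥

variable {E}

/-- Idempotents are nonzero by convention. -/
def IsJordanIdempotent (c : E) : Prop := c * c = c ∧ c ≠ 0

/-- A primitive idempotent is one that is not a sum of two (nonzero) idempotents. -/
def IsPrimitiveIdempotent (c : E) : Prop :=
  IsJordanIdempotent c ∧
    ¬ ∃ a b : E, IsJordanIdempotent a ∧ IsJordanIdempotent b ∧ c = a + b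

/-- A complete system of primitive orthogonal idempotents. -/
structure IsJordanFrame {n : ℕ} (c : Fin n → E) : Prop where
  primitive : ∀ j, IsPrimitiveIdempotent (c j)
  orthogonal : ∀ j k, j ≠ k → c j * c k = 0
  sum_eq_one : ∑ j, c j = 1

variable (E) in
/-- The rank: the (common) size of the complete systems of primitive orthogonal idempotents. -/
def jordanRank : ℕ := sInf {n : ℕ | ∃ c : Fin n → E, IsJordanFrame c}

/-- `d` is the product of the eigenvalues in some spectral decomposition of `x`. -/
def IsEigenvalueProduct (x : E) (d : ℝ) : Prop :=
  ∃ (n : ℕ) (c : Fin n → E) (l : Fin n → ℝ),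
    IsJordanFrame c ∧ x = ∑ j, l j • c j ∧ d = ∏ j, l j

open Classical in
/-- The determinant of `x`: the product of its eigenvalues. (Every `x` has a spectral
decomposition, and the product does not depend on it; the value `0` below never occurs by
default.) -/
def jordanDet (x : E) : ℝ :=
  if hd : ∃ d : ℝ, IsEigenvalueProduct x d then hd.choose else 0

variable (E) in
/-- The exponent `dim / r`. -/
def dimDivRank : ℝ := (Module.finrank ℝ E : ℝ) / (jordanRank E : ℝ)

variable (E) in
/-- The symmetric cone: the interior of the set of Jordan squares. -/
def jordanCone : Set E := interior {y : E | ∃ x : E, y = x * x}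

variable (E) in
/-- The analogue of the interval `(0, 1)`: all `x` in the cone with `1 - x` in the cone. -/
def jordanInterval : Set E := {x : E | x ∈ jordanCone E ∧ 1 - x ∈ jordanCone E}

variable (E) in
/-- The linear automorphisms of the space that preserve the cone, as a subset of the
(normed) space of endomorphisms. -/
def coneAut : Set (E →L[ℝ] E) :=
  {g | ∃ a : E ≃L[ℝ] E, (a : E →L[ℝ] E) = g ∧ a '' jordanCone E = jordanCone E}

variable (E) in
/-- The connected component of the identity in the group of cone automorphisms. -/
def coneAutIdComponent : Set (E →L[ℝ] E) :=
  connectedComponentIn (coneAut E) (ContinuousLinearMap.id ℝ E)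

/-- A multiplication algorithm: a map from the cone to the identity component of the group of cone
automorphisms with `w x 1 = x`. (The values of `w` outside the cone play no role.)
The corresponding division algorithm is `x ↦ (w x).symm`. -/
def IsMultiplicationAlgorithm (w : E → E ≃L[ℝ] E) : Prop :=
  ∀ x ∈ jordanCone E, (w x : E →L[ℝ] E) ∈ coneAutIdComponent E ∧ w x 1 = x

/-- Differentiability of `x ↦ w x` on the (open) cone, as a map to the space of endomorphisms. -/
def IsDifferentiableAlgorithm (w : E → E ≃L[ℝ] E) : Prop :=
  DifferentiableOn ℝ (fun x => (w x : E →L[ℝ] E)) (jordanCone E)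

/-- `w`-logarithmic functions on the cone. -/
def IsLogarithmicFor (w : E → E ≃L[ℝ] E) (l : E → ℝ) : Prop :=
  ∀ x ∈ jordanCone E, ∀ y ∈ jordanCone E, l x + l (w 1 y) = l (w x y)

/-- `w`-multiplicative functions on the cone: the exponentials of `w`-logarithmic functions. -/
def IsMultiplicativeFor (w : E → E ≃L[ℝ] E) (f : E → ℝ) : Prop :=
  ∃ l : E → ℝ, IsLogarithmicFor w l ∧ ∀ x ∈ jordanCone E, f x = Real.exp (l x)

/-- The (not normalized) density of the first variable,
`(det x)^(dim/r) i(x) h(x) f(1 - x)` on the interval and `0` elsewhere. -/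
def firstDensity (i f h : E → ℝ) : E → ℝ :=
  (jordanInterval E).indicator
    (fun x => jordanDet x ^ dimDivRank E * i x * h x * f (1 - x))

/-- The (not normalized) density of the second variable,
`h(w(1) x) i(1 - w(1) x)` on the interval and `0` elsewhere. -/
def secondDensity (w : E → E ≃L[ℝ] E) (i h : E → ℝ) : E → ℝ :=
  (jordanInterval E).indicator (fun x => h (w 1 x) * i (1 - w 1 x))

/-- The function `x ↦ (det x)^(p - dim/r)`. -/
def detPower (p : ℝ) (x : E) : ℝ := jordanDet x ^ (p - dimDivRank E)

/-- `U = 1 - w(X) Y`. -/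
def betaU (w : E → E ≃L[ℝ] E) {Ω : Type*} (X Y : Ω → E) (a : Ω) : E :=
  1 - w (X a) (Y a)

/-- `V = w'(U)⁻¹ (1 - X)`. -/
def betaV (w w' : E → E ≃L[ℝ] E) {Ω : Type*} (X Y : Ω → E) (a : Ω) : E :=
  (w' (betaU w X Y a)).symm (1 - X a)

end Algebra

section Laws

variable {E : Type*} [NormedAddCommGroup E] [InnerProductSpace ℝ E] [FiniteDimensional ℝ E]
  [MeasurableSpace E] [BorelSpace E]

/-- The law of `X` has the density `φ` with respect to Lebesgue measure. -/
def HasDensity {Ω : Type*} [MeasurableSpace Ω] (P : Measure Ω) (X : Ω → E) (φ : E → ℝ) : Prop :=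
  HasPDF X P volume ∧ pdf X P volume =ᵐ[volume] fun x => ENNReal.ofReal (φ x)

variable [EuclideanJordanAlgebra E]

/-- `(det x)^(p - dim/r) (det (1 - x))^(q - dim/r)` on the interval and `0` elsewhere. -/
def betaKernel (p q : ℝ) : E → ℝ≥0∞ :=
  (jordanInterval E).indicator
    (fun x => ENNReal.ofReal
      (jordanDet x ^ (p - dimDivRank E) * jordanDet (1 - x) ^ (q - dimDivRank E)))

variable (E) in
/-- The beta distribution with parameters `p`, `q`: the normalization of
`(det x)^(p - dim/r) (det (1 - x))^(q - dim/r) dx` on the interval. -/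
def jordanBeta (p q : ℝ) : Measure E :=
  (∫⁻ x : E, betaKernel p q x)⁻¹ • (volume : Measure E).withDensity (betaKernel p q)

end Laws

end

/-! The map $(x,y)\mapsto(u,v)$ is invertible, and its inverse has the same form with $w$ and
$\tilde w$ exchanged: $x=e-\tilde w(u)v$ and $y=w(x)^{-1}(e-u)$ (`betaMap_betaMap`). It is a
composition of two changes of one variable, $y\mapsto u$ for fixed $x$ and $x\mapsto v$ for fixed
$u$, each affine, so no derivative of $w$ or $\tilde w$ enters. The Jacobian of the inverse is
$|\mathrm{Det}\,\tilde w(u)|/|\mathrm{Det}\,w(x)|$ (`lintegral_betaMap`).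

For an automorphism $g$ of the cone, $|\mathrm{Det}\,g|=(\det ge)^{n/r}$ (`abs_det_eq`), so the
Jacobian is $(\det u/\det x)^{n/r}$. Multiplicativity gives $f(e-x)=f(u)f(\tilde w(e)v)$ and
$h(x)h(w(e)y)=h(e-u)$, while $i(x)i(e-w(e)y)$ and $i(u)i(e-\tilde w(e)v)$ are both $i(x+u-e)$. Hence
the joint density of $(U,V)$ is a product, of the original form with $f$ and $h$ exchanged
(`density_mul_betaJacobian`). Powers of $\det$ are multiplicative for every algorithm, which gives
the beta case.

The algebraic work is `abs_det_eq`. A point $x=\sum l_jc_j$ of the cone is the image of $e$ under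
$\exp L(a)$, $a=\sum\log(l_j)c_j$, whose determinant is $\exp\mathrm{tr}\,L(a)$. In a simple algebra
$\mathrm{tr}\,L(c)=n/r$ for each $c$ in a Jordan frame (`mulTrace_frame`). An automorphism fixing
$e$ preserves $\mathcal D$, which has positive finite volume, and so has determinant $\pm1$
(`abs_det_eq_one`). -/

namespace EuclideanJordanAlgebra

/-- The nonassociative ring structure underlying a Euclidean Jordan algebra. -/
abbrev toRing (E : Type*) [NormedAddCommGroup E] [InnerProductSpace ℝ E]
    [EuclideanJordanAlgebra E] : NonUnitalNonAssocCommRing E :=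
  { (inferInstance : AddCommGroup E), (inferInstance : Mul E) with
    left_distrib := mul_add'
    right_distrib := fun x y z => by
      rw [mul_comm' (x + y), mul_add', mul_comm' z x, mul_comm' z y]
    zero_mul := fun x => by
      rw [mul_comm']; simpa using mul_smul' (0 : ℝ) x (0 : E)
    mul_zero := fun x => by simpa using mul_smul' (0 : ℝ) x (0 : E)
    mul_comm := mul_comm' }

attribute [local instance] toRing

theorem smulCommClass (E : Type*) [NormedAddCommGroup E] [InnerProductSpace ℝ E]
    [EuclideanJordanAlgebra E] : SMulCommClass ℝ E E := ⟨fun t x y => (mul_smul' t x y).symm⟩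

theorem isScalarTower (E : Type*) [NormedAddCommGroup E] [InnerProductSpace ℝ E]
    [EuclideanJordanAlgebra E] : IsScalarTower ℝ E E :=
  ⟨fun t x y => by
    change (t • x) * y = t • (x * y)
    rw [mul_comm' (t • x), mul_smul', mul_comm' y]⟩

attribute [local instance] smulCommClass isScalarTower

/-! ### Polarized Jordan identities and the trace form. -/

section Basic

variable {E : Type*} [NormedAddCommGroup E] [InnerProductSpace ℝ E] [EuclideanJordanAlgebra E]

theorem inner_mul_left (x y z : E) : ⟪x * y, z⟫_ℝ = ⟪y, x * z⟫_ℝ := by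
  rw [mul_comm x y, inner_mul']

/-- The linearized Jordan identity. -/
theorem jordan_linearized (x z y : E) :
    z * ((x * x) * y) - (x * x) * (z * y) +
      (2 : ℝ) • (x * ((x * z) * y)) - (2 : ℝ) • ((x * z) * (x * y)) = 0 := by
  have h1 := jordan' (x + z) y
  have h2 := jordan' (x - z) y
  have h3 := jordan' z y
  simp only [add_mul, mul_add, sub_mul, mul_sub, mul_comm z x] at h1 h2 h3
  -- The difference of the identities for $x+z$ and $x-z$ is twice the part odd in $z$; the identity
  -- for $z$ alone removes its cubic term.
  have h4 : (2 : ℝ) • (z * ((x * x) * y) - (x * x) * (z * y) +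
      (2 : ℝ) • (x * ((x * z) * y)) - (2 : ℝ) • ((x * z) * (x * y))) = 0 := by
    linear_combination (norm := module) h1 - h2 - (2:ℝ) • h3
  simpa using h4

/-- Multiplication by `x² z` in terms of multiplication by `x`, `z`, `x²` and `x z`. -/
theorem sq_mul_mul (x z y : E) :
    ((x * x) * z) * y =
      (x * x) * (z * y) + (2 : ℝ) • ((x * z) * (x * y)) - (2 : ℝ) • (x * (z * (x * y))) := by
  have h := jordan_linearized x y z
  rw [mul_comm y ((x * x) * z), mul_comm y z, mul_comm (x * y) z, mul_comm (x * y)] at h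
  linear_combination (norm := module) h

theorem mul_mul_mul (x u z y : E) :
    ((x * u) * z) * y = (x * u) * (z * y) + (x * z) * (u * y) + (u * z) * (x * y)
      - x * (z * (u * y)) - u * (z * (x * y)) := by
  have h1 := sq_mul_mul (x + u) z y
  have h2 := sq_mul_mul x z y
  have h3 := sq_mul_mul u z y
  simp only [add_mul, mul_add, smul_add, mul_comm u x] at h1 h2 h3
  have h4 : (2 : ℝ) • (((x * u) * z) * y) = (2 : ℝ) • ((x * u) * (z * y) + (x * z) * (u * y)
      + (u * z) * (x * y) - x * (z * (u * y)) - u * (z * (x * y))) := by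
    linear_combination (norm := module) h1 - h2 - h3
  simpa using h4

variable (E) in
/-- Left multiplication as a linear map. -/
noncomputable abbrev mulL : E →ₗ[ℝ] E →ₗ[ℝ] E := LinearMap.mul ℝ E

theorem isSymmetric_mulL (x : E) : (mulL E x).IsSymmetric := fun y z => inner_mul_left x y z

/-- The trace of the multiplication operator. -/
noncomputable def mulTrace (x : E) : ℝ := LinearMap.trace ℝ E (mulL E x)

theorem mulTrace_smul (t : ℝ) (x : E) : mulTrace (t • x) = t * mulTrace x := by
  simp [mulTrace]

theorem mulTrace_sub (x y : E) : mulTrace (x - y) = mulTrace x - mulTrace y := by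
  simp [mulTrace]

theorem mulTrace_sum {ι : Type*} (s : Finset ι) (f : ι → E) :
    mulTrace (∑ i ∈ s, f i) = ∑ i ∈ s, mulTrace (f i) := by
  simp [mulTrace]

theorem one_mul' (x : E) : 1 * x = x := by rw [mul_comm', mul_one']

theorem mulTrace_one [FiniteDimensional ℝ E] : mulTrace (1 : E) = Module.finrank ℝ E := by
  have : mulL E 1 = LinearMap.id := by ext x; exact one_mul' x
  rw [mulTrace, this, LinearMap.trace_id]

/-- By `mul_mul_mul`, $L((xu)z)-L((xz)u)$ is a difference of two commutators,
$[L(x),L(u)L(z)]-[L(x),L(z)L(u)]$. It follows that the trace form is associative. -/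
theorem mulTrace_mul_right_comm (x u z : E) :
    mulTrace ((x * u) * z) = mulTrace ((x * z) * u) := by
  have h : mulL E ((x * u) * z) - mulL E ((x * z) * u) =
      (mulL E x * (mulL E u * mulL E z) - (mulL E u * mulL E z) * mulL E x)
      - (mulL E x * (mulL E z * mulL E u) - (mulL E z * mulL E u) * mulL E x) := by
    ext y
    have h1 := mul_mul_mul x u z y
    have h2 := mul_mul_mul x z u y
    rw [mul_comm z u] at h2
    simp only [LinearMap.sub_apply, Module.End.mul_apply, LinearMap.mul_apply']
    linear_combination (norm := module) h1 - h2
  have h' := congrArg (LinearMap.trace ℝ E) h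
  simp only [map_sub] at h'
  rw [LinearMap.trace_mul_comm ℝ (mulL E x) (mulL E u * mulL E z),
    LinearMap.trace_mul_comm ℝ (mulL E x) (mulL E z * mulL E u), sub_self, sub_self, sub_self] at h'
  exact sub_eq_zero.1 h'

theorem mulTrace_mul_mul (c a b : E) : mulTrace (c * (a * b)) = mulTrace ((c * a) * b) := by
  rw [mul_comm, mulTrace_mul_right_comm, mul_comm a c]

end Basic

/-! ### Peirce theory of an idempotent. -/

section Peirce

variable {E : Type*} [NormedAddCommGroup E] [InnerProductSpace ℝ E] [EuclideanJordanAlgebra E]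

variable {c x y a : E}

theorem mul_left_comm_of_mul_eq_self (hc : c * c = c) (hx : c * x = x) (y : E) :
    x * (c * y) = c * (x * y) := by
  have h := jordan_linearized c x y
  rw [hc, hx] at h
  linear_combination (norm := module) -h

theorem mul_left_comm_of_mul_eq_zero (hc : c * c = c) (hx : c * x = 0) (y : E) :
    x * (c * y) = c * (x * y) := by
  have h := jordan_linearized c x y
  rw [hc, hx] at h
  simp only [zero_mul, mul_zero, smul_zero] at h
  linear_combination (norm := module) h

/-- $L(c)$ is annihilated by $2t^3-3t^2+t$, so its eigenvalues lie in $\{0,\tfrac12,1\}$. The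
projection onto the eigenspace of $1$ is $2L(c)^2-L(c)$, an expression that recurs below. -/
theorem peirce_polynomial (hc : c * c = c) (y : E) :
    (2 : ℝ) • (c * (c * (c * y))) = (3 : ℝ) • (c * (c * y)) - c * y := by
  have h := sq_mul_mul c c y
  rw [hc, hc] at h
  linear_combination (norm := module) h

theorem mul_eq_zero_of_peirce (hc : c * c = c) (hx : c * x = x) (hy : c * y = 0) : x * y = 0 := by
  have h1 := mul_left_comm_of_mul_eq_self hc hx y
  have h2 := mul_left_comm_of_mul_eq_zero hc hy x
  rw [hy, mul_zero] at h1
  rw [hx, mul_comm y x, ← h1] at h2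
  exact h2

theorem mul_mul_self_of_half (hc : c * c = c) (ha : c * a = (2⁻¹ : ℝ) • a) :
    c * (c * (a * a)) = c * (a * a) := by
  have h := sq_mul_mul a c c
  rw [mul_comm a c, ha, hc, mul_comm (a * a) c] at h
  simp only [smul_mul_assoc, mul_smul_comm, ha] at h
  rw [mul_comm _ c] at h
  linear_combination (norm := module) h

/-- The form is $|x_1|^2+\tfrac12|x_{1/2}|^2$ in Peirce components. The two squared norms in the
proof are those of $x_1=(2L(c)^2-L(c))x$ and of $\tfrac14x_{1/2}=(L(c)-L(c)^2)x$. -/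
theorem inner_mul_self_nonneg (hc : c * c = c) (x : E) : 0 ≤ ⟪x, c * x⟫_ℝ := by
  have h1 : ⟪(2 : ℝ) • (c * (c * x)) - c * x, (2 : ℝ) • (c * (c * x)) - c * x⟫_ℝ ≥ 0 :=
    real_inner_self_nonneg
  have h2 : ⟪c * x - c * (c * x), c * x - c * (c * x)⟫_ℝ ≥ 0 := real_inner_self_nonneg
  have h3 : (2 : ℝ) * ⟪c * x, c * (c * x)⟫_ℝ = 3 * ⟪c * x, c * x⟫_ℝ - ⟪x, c * x⟫_ℝ := by
    have := congrArg (fun y => ⟪x, y⟫_ℝ) (peirce_polynomial hc x)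
    simp only [inner_smul_right, inner_sub_right] at this
    rw [inner_mul_left c x, inner_mul_left c x]; linarith
  have h4 : (2 : ℝ) * ⟪c * (c * x), c * (c * x)⟫_ℝ
      = 3 * ⟪c * x, c * (c * x)⟫_ℝ - ⟪c * x, c * x⟫_ℝ := by
    have := congrArg (fun y => ⟪c * x, y⟫_ℝ) (peirce_polynomial hc x)
    simp only [inner_smul_right, inner_sub_right] at this
    rw [inner_mul_left c (c * x)]; linarith
  simp only [inner_sub_left, inner_sub_right, inner_smul_left, inner_smul_right,
    real_inner_comm (c * x) (c * (c * x)), conj_trivial] at h1 h2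
  linarith

end Peirce

/-! ### Spectral decomposition inside a Peirce subalgebra. -/

section Spectral

variable {E : Type*} [NormedAddCommGroup E] [InnerProductSpace ℝ E] [EuclideanJordanAlgebra E]

theorem mulL_pow_succ (x c : E) (k : ℕ) : (mulL E x ^ (k + 1)) c = x * (mulL E x ^ k) c := by
  rw [pow_succ', Module.End.mul_apply]; rfl

/-- The powers of `x` in the Peirce subalgebra of the idempotent `c` commute with `x`. -/
theorem mulL_pow_commute {c x : E} (hc : c * c = c) (hx : c * x = x) (k : ℕ) :
    c * (mulL E x ^ k) c = (mulL E x ^ k) c ∧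
      ∀ z, x * ((mulL E x ^ k) c * z) = (mulL E x ^ k) c * (x * z) := by
  set y : ℕ → E := fun k => (mulL E x ^ k) c with hy
  have y0 : y 0 = c := by simp [hy]
  have ys : ∀ k, y (k + 1) = x * y k := fun k => mulL_pow_succ x c k
  have y1 : y 1 = x := by rw [ys, y0, mul_comm, hx]
  have hj : ∀ z, x * ((x * x) * z) = (x * x) * (x * z) := jordan' x
  have hsq : ∀ k, (x * x) * y k = x * (x * y k) := by
    intro k
    induction k with
    | zero =>
      rw [y0, mul_comm x c, hx, mul_comm (x * x) c, ← mul_left_comm_of_mul_eq_self hc hx, hx]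
    | succ k ih => rw [ys, ← hj, ih]
  -- The induction carries two consecutive powers because $y_{k+2}=x^2y_k$, and `sq_mul_mul`
  -- expresses $L(x^2y_k)$ through $L(x^2)$, $L(x)$, $L(y_k)$, $L(y_{k+1})$. Commutation with
  -- $L(x^2)$ as well as $L(x)$ is needed to pass through that formula.
  have key : ∀ k, (c * y k = y k ∧ (∀ z, x * (y k * z) = y k * (x * z)) ∧
      ∀ z, (x * x) * (y k * z) = y k * ((x * x) * z)) ∧
      (c * y (k + 1) = y (k + 1) ∧ (∀ z, x * (y (k + 1) * z) = y (k + 1) * (x * z)) ∧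
      ∀ z, (x * x) * (y (k + 1) * z) = y (k + 1) * ((x * x) * z)) := by
    intro k
    induction k with
    | zero =>
      rw [zero_add, y0, y1]
      have hxx : c * (x * x) = x * x := by rw [← mul_left_comm_of_mul_eq_self hc hx, hx]
      exact ⟨⟨hc, mul_left_comm_of_mul_eq_self hc hx, mul_left_comm_of_mul_eq_self hc hxx⟩,
        hx, fun _ => rfl, fun z => (hj z).symm⟩
    | succ k ih =>
      refine ⟨ih.2, ?_⟩
      obtain ⟨⟨-, a2, a3⟩, b1, b2, b3⟩ := ih
      have hL : ∀ z, y (k + 1 + 1) * z =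
          (x * x) * (y k * z) + (2 : ℝ) • (y (k + 1) * (x * z)) -
            (2 : ℝ) • (x * (y k * (x * z))) := by
        intro z
        rw [ys, ys, ← hsq, sq_mul_mul]
      refine ⟨?_, ?_, ?_⟩
      · rw [ys (k + 1), ← mul_left_comm_of_mul_eq_self hc hx, b1]
      · intro z
        rw [hL, hL]
        simp only [mul_add, mul_sub, mul_smul_comm]
        rw [hj, a2, b2, a2 (x * z)]
      · intro z
        rw [hL, hL]
        simp only [mul_add, mul_sub, mul_smul_comm]
        rw [a3, b3, hj z, ← hj (y k * (x * z)), a3 (x * z)]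
  exact ⟨(key k).1.1, (key k).1.2.1⟩

variable [FiniteDimensional ℝ E]

/-- The spectral theorem in the Peirce subalgebra of the idempotent `c`. -/
theorem exists_spectral {c x : E} (hc : c * c = c) (hx : c * x = x) :
    ∃ (s : Finset ℝ) (p : ℝ → E), (∀ l ∈ s, p l ≠ 0) ∧ (∀ l, x * p l = l • p l) ∧
      (∀ l, c * p l = p l) ∧ (∀ l m, l ≠ m → p l * p m = 0) ∧ (∀ l, p l * p l = p l) ∧
      c = ∑ l ∈ s, p l ∧ x = ∑ l ∈ s, l • p l := by
  set S : Submodule ℝ E := Submodule.span ℝ (Set.range fun k : ℕ => (mulL E x ^ k) c) with hS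
  have hcS : c ∈ S := Submodule.subset_span ⟨0, by simp⟩
  have hinv : ∀ y ∈ S, mulL E x y ∈ S := by
    intro y hy
    induction hy using Submodule.span_induction with
    | mem y hy =>
      obtain ⟨k, rfl⟩ := hy
      exact Submodule.subset_span ⟨k + 1, mulL_pow_succ x c k⟩
    | zero => simp
    | add y z _ _ hy hz => rw [map_add]; exact add_mem hy hz
    | smul t y _ hy => rw [map_smul]; exact S.smul_mem t hy
  have hprop : ∀ y ∈ S, c * y = y ∧ ∀ z, x * (y * z) = y * (x * z) := by
    intro y hy
    induction hy using Submodule.span_induction with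
    | mem y hy =>
      obtain ⟨k, rfl⟩ := hy
      exact mulL_pow_commute hc hx k
    | zero => simp
    | add y z _ _ hy hz => simp [mul_add, add_mul, hy.1, hz.1, hy.2, hz.2]
    | smul t y _ hy => simp [mul_smul_comm, smul_mul_assoc, hy.1, hy.2]
  have hT := (isSymmetric_mulL x).restrict_invariant hinv
  have htop : ⨆ l, Module.End.eigenspace ((mulL E x).restrict hinv) l = ⊤ :=
    Submodule.orthogonal_eq_bot_iff.1 hT.orthogonalComplement_iSup_eigenspaces_eq_bot
  have hmem : (⟨c, hcS⟩ : S) ∈ ⨆ l, Module.End.eigenspace ((mulL E x).restrict hinv) l :=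
    htop ▸ Submodule.mem_top
  -- The spectral idempotents are the components of $c$ in the eigenspaces of the symmetric operator
  -- $L(x)$ on the span of the powers of $x$.
  obtain ⟨q, hq, hsum⟩ := (Submodule.mem_iSup_iff_exists_finsupp _ _).1 hmem
  have hsum' : c = ∑ l ∈ q.support, (q l : E) := by
    have := congrArg (Subtype.val) hsum
    rw [Finsupp.sum] at this
    simpa using this.symm
  have hxq : ∀ l, x * (q l : E) = l • (q l : E) := by
    intro l
    have := congrArg Subtype.val (Module.End.mem_eigenspace_iff.1 (hq l))
    exact this
  -- $L(x)$ commutes with $L(q_l)$ and $L(q_m)$, so $q_lq_m$ is multiplied by $x$ both as $m$ and as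
  -- $l$.
  have horth : ∀ l m, l ≠ m → (q l : E) * (q m : E) = 0 := by
    intro l m hlm
    have h1 := (hprop _ (q l).2).2 (q m : E)
    have h2 := (hprop _ (q m).2).2 (q l : E)
    rw [hxq, mul_smul_comm] at h1 h2
    rw [mul_comm (q m : E)] at h2
    have h3 : (l - m) • ((q l : E) * (q m : E)) = 0 := by
      rw [sub_smul, ← h1, ← h2, sub_self]
    exact (smul_eq_zero.1 h3).resolve_left (sub_ne_zero.2 hlm)
  have hxc : x * c = x := by rw [mul_comm, hx]
  refine ⟨q.support, fun l => q l, ?_, hxq, fun l => (hprop _ (q l).2).1, horth, ?_, hsum', ?_⟩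
  · intro l hl h
    exact Finsupp.mem_support_iff.1 hl (Subtype.ext h)
  · intro l
    by_cases hl : l ∈ q.support
    · have h := (hprop _ (q l).2).1
      rw [mul_comm, hsum', Finset.mul_sum, Finset.sum_eq_single_of_mem l hl] at h
      · exact h
      · intro m _ hm
        exact horth l m hm.symm
    · rw [Finsupp.notMem_support_iff] at hl
      simp [hl]
  · conv_lhs => rw [← hxc, hsum', Finset.mul_sum]
    exact Finset.sum_congr rfl fun l _ => hxq l

/-- The spectral idempotents of $x$ sum to $c$; primitivity leaves room for only one of them. -/
theorem isPrimitive_peirce_one {c x : E} (hc : IsPrimitiveIdempotent c) (hx : c * x = x) :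
    ∃ t : ℝ, x = t • c := by
  obtain ⟨⟨hcc, hc0⟩, hprim⟩ := hc
  obtain ⟨s, p, h0, -, h1, horth, hidem, hsum, hxs⟩ := exists_spectral hcc hx
  have hs : s.Nonempty := by
    by_contra h
    rw [Finset.not_nonempty_iff_eq_empty] at h
    rw [h, Finset.sum_empty] at hsum
    exact hc0 hsum
  obtain ⟨l, hl⟩ := hs
  have hcl : c - p l = 0 := by
    by_contra hne
    refine hprim ⟨p l, c - p l, ⟨hidem l, h0 l hl⟩, ⟨?_, hne⟩, by abel⟩
    rw [mul_sub, sub_mul, sub_mul, hcc, h1, mul_comm (p l) c, h1, hidem]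
    abel
  have hcl' := sub_eq_zero.1 hcl
  refine ⟨l, ?_⟩
  rw [hcl', hxs, Finset.sum_eq_single_of_mem l hl]
  intro m hm hml
  exfalso
  apply h0 m hm
  rw [← h1 m, hcl', horth l m hml.symm]

end Spectral

/-! ### Existence of Jordan frames. -/

section Frames

variable {E : Type*} [NormedAddCommGroup E] [InnerProductSpace ℝ E] [EuclideanJordanAlgebra E]

theorem inner_eq_zero_of_mul_eq_zero {c d : E} (hc : c * c = c) (h : c * d = 0) :
    ⟪c, d⟫_ℝ = 0 := by
  rw [← hc, inner_mul_left, h, inner_zero_right]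

/-- A finite system of orthogonal idempotents with sum `1` that diagonalizes `x`. -/
structure IsDiagonalSystem (x : E) (S : Finset E) : Prop where
  idem : ∀ c ∈ S, c * c = c
  ne_zero : ∀ c ∈ S, c ≠ 0
  orth : ∀ c ∈ S, ∀ d ∈ S, c ≠ d → c * d = 0
  sum_eq : ∑ c ∈ S, c = 1
  eigen : ∀ c ∈ S, ∃ t : ℝ, x * c = t • c

/-- Squaring $c=a+b$ gives $ab=0$. Both parts then lie in the Peirce 1-space of $c$, so they
annihilate the other members and $x$ acts on them by the same scalar as on $c$. -/
theorem IsDiagonalSystem.split {x : E} {S : Finset E} (h : IsDiagonalSystem x S) {c a b : E}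
    (hc : c ∈ S) (ha : IsJordanIdempotent a) (hb : IsJordanIdempotent b) (hab : c = a + b) :
    ∃ S' : Finset E, IsDiagonalSystem x S' ∧ S'.card = S.card + 1 := by
  classical
  have hab0 : a * b = 0 := by
    have h1 := h.idem c hc
    rw [hab] at h1
    simp only [add_mul, mul_add, ha.1, hb.1, mul_comm b a] at h1
    have h2 : (2 : ℝ) • (a * b) = 0 := by linear_combination (norm := module) h1
    simpa using h2
  have hba0 : b * a = 0 := by rw [mul_comm, hab0]
  have hca : c * a = a := by rw [hab, add_mul, ha.1, hba0, add_zero]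
  have hcb : c * b = b := by rw [hab, add_mul, hb.1, hab0, zero_add]
  have hcd : ∀ d ∈ S.erase c, c * d = 0 := fun d hd =>
    h.orth c hc d (Finset.mem_of_mem_erase hd) (Finset.ne_of_mem_erase hd).symm
  have had : ∀ d ∈ S.erase c, a * d = 0 := fun d hd =>
    mul_eq_zero_of_peirce (h.idem c hc) hca (hcd d hd)
  have hbd : ∀ d ∈ S.erase c, b * d = 0 := fun d hd =>
    mul_eq_zero_of_peirce (h.idem c hc) hcb (hcd d hd)
  have hne : a ≠ b := fun e => ha.2 (by rw [← ha.1]; nth_rw 2 [e]; exact hab0)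
  have haS : a ∉ S.erase c := fun hm => ha.2 (by rw [← ha.1]; exact had a hm)
  have hbS : b ∉ S.erase c := fun hm => hb.2 (by rw [← hb.1]; exact hbd b hm)
  have haS' : a ∉ insert b (S.erase c) := by simp only [Finset.mem_insert, not_or]; exact ⟨hne, haS⟩
  obtain ⟨t, ht⟩ := h.eigen c hc
  have hx : x = ∑ d ∈ S, x * d := by
    rw [← Finset.mul_sum, h.sum_eq, mul_one']
  have hxc : ∀ e, c * e = e → (∀ d ∈ S.erase c, d * e = 0) → x * e = t • e := by
    intro e h1 h2
    rw [hx, Finset.sum_mul, ← Finset.add_sum_erase _ _ hc, Finset.sum_eq_zero, ht, smul_mul_assoc,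
      h1, add_zero]
    intro d hd
    obtain ⟨s, hs⟩ := h.eigen d (Finset.mem_of_mem_erase hd)
    rw [hs, smul_mul_assoc, h2 d hd, smul_zero]
  refine ⟨insert a (insert b (S.erase c)), ⟨?_, ?_, ?_, ?_, ?_⟩, ?_⟩
  · intro d hd
    simp only [Finset.mem_insert] at hd
    rcases hd with rfl | rfl | hd
    · exact ha.1
    · exact hb.1
    · exact h.idem d (Finset.mem_of_mem_erase hd)
  · intro d hd
    simp only [Finset.mem_insert] at hd
    rcases hd with rfl | rfl | hd
    · exact ha.2
    · exact hb.2
    · exact h.ne_zero d (Finset.mem_of_mem_erase hd)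
  · intro d hd e he hde
    simp only [Finset.mem_insert] at hd he
    rcases hd with rfl | rfl | hd <;> rcases he with rfl | rfl | he
    · exact absurd rfl hde
    · exact hab0
    · exact had e he
    · exact hba0
    · exact absurd rfl hde
    · exact hbd e he
    · rw [mul_comm]; exact had d hd
    · rw [mul_comm]; exact hbd d hd
    · exact h.orth d (Finset.mem_of_mem_erase hd) e (Finset.mem_of_mem_erase he) hde
  · rw [Finset.sum_insert haS', Finset.sum_insert hbS, ← add_assoc, ← hab,
      Finset.add_sum_erase S (fun c => c) hc, h.sum_eq]
  · intro d hd
    simp only [Finset.mem_insert] at hd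
    rcases hd with rfl | rfl | hd
    · exact ⟨t, hxc _ hca fun d hd => by rw [mul_comm]; exact had d hd⟩
    · exact ⟨t, hxc _ hcb fun d hd => by rw [mul_comm]; exact hbd d hd⟩
    · exact h.eigen d (Finset.mem_of_mem_erase hd)
  · rw [Finset.card_insert_of_notMem haS', Finset.card_insert_of_notMem hbS,
      Finset.card_erase_add_one hc]

variable [FiniteDimensional ℝ E]

theorem IsDiagonalSystem.card_le {x : E} {S : Finset E} (h : IsDiagonalSystem x S) :
    S.card ≤ Module.finrank ℝ E := by
  have : LinearIndependent ℝ (fun c : S => (c : E)) :=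
    linearIndependent_of_ne_zero_of_inner_eq_zero (𝕜 := ℝ) (fun c => h.ne_zero c c.2)
      fun c d hcd => inner_eq_zero_of_mul_eq_zero (h.idem c c.2)
        (h.orth c c.2 d d.2 fun e => hcd (Subtype.ext e))
  simpa using this.fintype_card_le_finrank

theorem exists_isDiagonalSystem (x : E) : ∃ S : Finset E, IsDiagonalSystem x S := by
  classical
  obtain ⟨s, p, h0, heig, -, horth, hidem, hsum, -⟩ :=
    exists_spectral (c := (1 : E)) (one_mul' 1) (one_mul' x)
  have hinj : Set.InjOn p s := by
    intro l hl m hm hlm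
    by_contra hne
    apply h0 l hl
    rw [← hidem l]; nth_rw 2 [hlm]; exact horth l m hne
  refine ⟨s.image p, ⟨?_, ?_, ?_, ?_, ?_⟩⟩
  · simp only [Finset.mem_image]; rintro _ ⟨l, -, rfl⟩; exact hidem l
  · simp only [Finset.mem_image]; rintro _ ⟨l, hl, rfl⟩; exact h0 l hl
  · simp only [Finset.mem_image]; rintro _ ⟨l, -, rfl⟩ _ ⟨m, -, rfl⟩ h
    exact horth l m fun e => h (congrArg p e)
  · rw [Finset.sum_image hinj, hsum]
  · simp only [Finset.mem_image]; rintro _ ⟨l, -, rfl⟩; exact ⟨l, heig l⟩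

/-- Every element has a spectral decomposition with respect to some Jordan frame. -/
theorem exists_isJordanFrame (x : E) :
    ∃ (n : ℕ) (c : Fin n → E) (l : Fin n → ℝ), IsJordanFrame c ∧ x = ∑ j, l j • c j := by
  classical
  have hne : {k | ∃ S : Finset E, IsDiagonalSystem x S ∧ S.card = k}.Nonempty := by
    obtain ⟨S, hS⟩ := exists_isDiagonalSystem x
    exact ⟨_, S, hS, rfl⟩
  have hbdd : BddAbove {k | ∃ S : Finset E, IsDiagonalSystem x S ∧ S.card = k} :=
    ⟨Module.finrank ℝ E, by rintro _ ⟨S, hS, rfl⟩; exact hS.card_le⟩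
  -- In a diagonal system of largest cardinality every member is primitive, since a decomposition
  -- would enlarge the system.
  obtain ⟨S, hS, hcard⟩ := Nat.sSup_mem hne hbdd
  have hsum : ∀ f : E → E, ∑ j, f (S.equivFin.symm j : E) = ∑ c ∈ S, f c := by
    intro f
    rw [Equiv.sum_comp S.equivFin.symm (fun c : S => f c), Finset.sum_coe_sort S f]
  choose! t ht using hS.eigen
  refine ⟨S.card, fun j => (S.equivFin.symm j : E), fun j => t (S.equivFin.symm j : E),
    ⟨?_, ?_, ?_⟩, ?_⟩
  · intro j
    have hj := (S.equivFin.symm j).2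
    refine ⟨⟨hS.idem _ hj, hS.ne_zero _ hj⟩, ?_⟩
    rintro ⟨a, b, ha, hb, hab⟩
    obtain ⟨S', hS', hc⟩ := hS.split hj ha hb hab
    have := le_csSup hbdd ⟨S', hS', rfl⟩
    omega
  · intro j k hjk
    exact hS.orth _ (S.equivFin.symm j).2 _ (S.equivFin.symm k).2
      fun e => hjk (S.equivFin.symm.injective (Subtype.ext e))
  · rw [hsum (fun c => c), hS.sum_eq]
  · rw [hsum (fun c => t c • c), ← mul_one' x, ← hS.sum_eq, Finset.mul_sum]
    exact Finset.sum_congr rfl fun c hc => ht c hc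

end Frames

section FrameLemmas

variable {E : Type*} [NormedAddCommGroup E] [InnerProductSpace ℝ E] [EuclideanJordanAlgebra E]
  {n : ℕ} {c : Fin n → E}

theorem _root_.IsJordanFrame.mul_self (hc : IsJordanFrame c) (j : Fin n) : c j * c j = c j :=
  (hc.primitive j).1.1

theorem _root_.IsJordanFrame.ne_zero (hc : IsJordanFrame c) (j : Fin n) : c j ≠ 0 :=
  (hc.primitive j).1.2

theorem _root_.IsJordanFrame.inner_self_pos (hc : IsJordanFrame c) (j : Fin n) :
    0 < ⟪c j, c j⟫_ℝ := real_inner_self_pos.2 (hc.ne_zero j)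

theorem _root_.IsJordanFrame.mul_sum (hc : IsJordanFrame c) (l : Fin n → ℝ) (j : Fin n) :
    c j * ∑ k, l k • c k = l j • c j := by
  rw [Finset.mul_sum, Finset.sum_eq_single j, mul_smul_comm, hc.mul_self]
  · intro k _ hk
    rw [mul_smul_comm, hc.orthogonal j k hk.symm, smul_zero]
  · simp

theorem _root_.IsJordanFrame.inner_sum (hc : IsJordanFrame c) (l : Fin n → ℝ) (j : Fin n) :
    ⟪∑ k, l k • c k, c j⟫_ℝ = l j * ⟪c j, c j⟫_ℝ := by
  rw [real_inner_comm]
  nth_rw 1 [← hc.mul_self j]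
  rw [inner_mul_left, hc.mul_sum, inner_smul_right]

theorem _root_.IsJordanFrame.sum_mul_sum (hc : IsJordanFrame c) (l m : Fin n → ℝ) :
    (∑ k, l k • c k) * ∑ k, m k • c k = ∑ k, (l k * m k) • c k := by
  rw [Finset.sum_mul]
  refine Finset.sum_congr rfl fun j _ => ?_
  rw [smul_mul_assoc, hc.mul_sum, smul_smul]

end FrameLemmas

/-! ### The cone of squares and its self-duality. -/

section Cone

variable {E : Type*} [NormedAddCommGroup E] [InnerProductSpace ℝ E] [EuclideanJordanAlgebra E]

variable (E) in
/-- The set of Jordan squares. -/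
def squares : Set E := {y : E | ∃ x : E, y = x * x}

theorem jordanCone_eq : jordanCone E = interior (squares E) := rfl

theorem jordanCone_subset_squares : jordanCone E ⊆ squares E := interior_subset

theorem isOpen_jordanCone : IsOpen (jordanCone E) := isOpen_interior

end Cone

section Squares

variable {E : Type*} [NormedAddCommGroup E] [InnerProductSpace ℝ E] [EuclideanJordanAlgebra E]
  [FiniteDimensional ℝ E]

/-- Diagonalizing $y$ reduces this to $\langle x^2,c_j\rangle=\langle x,c_jx\rangle\ge0$. -/
theorem inner_squares_nonneg {x y : E} (hx : x ∈ squares E) (hy : y ∈ squares E) :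
    0 ≤ ⟪x, y⟫_ℝ := by
  obtain ⟨x, rfl⟩ := hx
  obtain ⟨y, rfl⟩ := hy
  obtain ⟨n, c, l, hc, rfl⟩ := exists_isJordanFrame y
  rw [hc.sum_mul_sum, inner_sum]
  refine Finset.sum_nonneg fun j _ => ?_
  rw [inner_smul_right, inner_mul_left, mul_comm x (c j)]
  exact mul_nonneg (mul_self_nonneg _) (inner_mul_self_nonneg (hc.mul_self j) x)

theorem sum_mem_squares_iff {n : ℕ} {c : Fin n → E} (hc : IsJordanFrame c) {l : Fin n → ℝ} :
    ∑ j, l j • c j ∈ squares E ↔ ∀ j, 0 ≤ l j := by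
  constructor
  · intro h j
    have h1 := inner_squares_nonneg h ⟨c j, (hc.mul_self j).symm⟩
    rw [hc.inner_sum] at h1
    exact nonneg_of_mul_nonneg_left h1 (hc.inner_self_pos j)
  · intro h
    refine ⟨∑ j, √(l j) • c j, ?_⟩
    rw [hc.sum_mul_sum]
    exact Finset.sum_congr rfl fun j _ => by rw [Real.mul_self_sqrt (h j)]

/-- Self-duality: testing against the members of a frame of $y$ reads off the signs of the
eigenvalues. Closedness and stability under addition follow at once. -/
theorem mem_squares_iff {y : E} : y ∈ squares E ↔ ∀ z ∈ squares E, 0 ≤ ⟪y, z⟫_ℝ := by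
  refine ⟨fun h z hz => inner_squares_nonneg h hz, fun h => ?_⟩
  obtain ⟨n, c, l, hc, rfl⟩ := exists_isJordanFrame y
  rw [sum_mem_squares_iff hc]
  intro j
  have h1 := h (c j) ⟨c j, (hc.mul_self j).symm⟩
  rw [hc.inner_sum] at h1
  exact nonneg_of_mul_nonneg_left h1 (hc.inner_self_pos j)

theorem isClosed_squares : IsClosed (squares E) := by
  have : squares E = ⋂ z ∈ squares E, {y | 0 ≤ ⟪y, z⟫_ℝ} := by
    ext y; simp [mem_squares_iff (y := y)]
  rw [this]
  exact isClosed_biInter fun z _ => isClosed_le continuous_const (by fun_prop)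

theorem add_mem_squares {x y : E} (hx : x ∈ squares E) (hy : y ∈ squares E) :
    x + y ∈ squares E :=
  mem_squares_iff.2 fun z hz => by
    rw [inner_add_left]
    exact add_nonneg (inner_squares_nonneg hx hz) (inner_squares_nonneg hy hz)

theorem add_mem_jordanCone {x y : E} (hx : x ∈ jordanCone E) (hy : y ∈ jordanCone E) :
    x + y ∈ jordanCone E := by
  have h1 : (Homeomorph.addRight y) '' jordanCone E ⊆ squares E := by
    rintro _ ⟨z, hz, rfl⟩
    exact add_mem_squares (interior_subset hz) (interior_subset hy)
  exact interior_maximal h1 ((Homeomorph.addRight y).isOpenMap _ isOpen_interior) ⟨x, hx, rfl⟩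

theorem pos_of_sum_mem_jordanCone {n : ℕ} {c : Fin n → E} (hc : IsJordanFrame c) {l : Fin n → ℝ}
    (h : ∑ j, l j • c j ∈ jordanCone E) (j : Fin n) : 0 < l j := by
  have hcont : Continuous fun t : ℝ => ∑ j, l j • c j - t • c j := by fun_prop
  have hmem : (fun t : ℝ => ∑ j, l j • c j - t • c j) ⁻¹' jordanCone E ∈ nhds (0 : ℝ) :=
    hcont.continuousAt.preimage_mem_nhds (isOpen_jordanCone.mem_nhds (by simpa using h))
  obtain ⟨ε, hε, hball⟩ := Metric.mem_nhds_iff.1 hmem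
  have h1 : ∑ j, l j • c j - (ε / 2) • c j ∈ squares E :=
    jordanCone_subset_squares (hball (by simp [abs_of_pos hε, hε]))
  have h2 := inner_squares_nonneg h1 ⟨c j, (hc.mul_self j).symm⟩
  rw [inner_sub_left, hc.inner_sum, inner_smul_left, conj_trivial, ← sub_mul] at h2
  have := nonneg_of_mul_nonneg_left h2 (hc.inner_self_pos j)
  linarith

/-- Left multiplication as a continuous linear map. -/
noncomputable def mulCLM : E →ₗ[ℝ] E →L[ℝ] E :=
  (LinearMap.toContinuousLinearMap : (E →ₗ[ℝ] E) ≃ₗ[ℝ] (E →L[ℝ] E)).toLinearMap ∘ₗ mulL E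

theorem mulCLM_apply (x y : E) : mulCLM x y = x * y := rfl

/-- For $\|L(y-e)\|<1$, $\langle y,z^2\rangle=|z|^2+\langle(y-e)z,z\rangle\ge0$, so $y$ is a square
by self-duality. -/
theorem one_mem_jordanCone : (1 : E) ∈ jordanCone E := by
  rw [jordanCone_eq, mem_interior]
  have hcont : Continuous fun y : E => ‖mulCLM (y - 1)‖ :=
    ((LinearMap.continuous_of_finiteDimensional (mulCLM (E := E))).comp
      (continuous_id.sub continuous_const)).norm
  refine ⟨{y | ‖mulCLM (y - 1)‖ < 1}, ?_, isOpen_lt hcont continuous_const, by simp⟩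
  intro y hy
  rw [mem_squares_iff]
  rintro _ ⟨z, rfl⟩
  have h1 : ⟪y, z * z⟫_ℝ = ⟪z, z⟫_ℝ + ⟪(y - 1) * z, z⟫_ℝ := by
    rw [inner_mul', sub_mul, inner_sub_left, one_mul']; ring
  have h2 : |⟪(y - 1) * z, z⟫_ℝ| ≤ ‖z‖ * ‖z‖ := by
    refine (abs_real_inner_le_norm _ _).trans ?_
    gcongr
    rw [← mulCLM_apply]
    refine ((mulCLM (y - 1)).le_opNorm z).trans ?_
    have : ‖mulCLM (y - 1)‖ ≤ 1 := le_of_lt hy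
    nlinarith [norm_nonneg z]
  rw [h1, real_inner_self_eq_norm_mul_norm]
  linarith [neg_abs_le ⟪(y - 1) * z, z⟫_ℝ]

end Squares

/-! ### Traces of primitive idempotents and the rank. -/

section HalfSpace

variable {E : Type*} [NormedAddCommGroup E] [InnerProductSpace ℝ E] [EuclideanJordanAlgebra E]

/-- Multiplication by $c$ kills the 0-component of $x$ and multiplication by $d$ kills the
1-component; what is left is in the half space of $c$, which $L(d)$ preserves because it commutes
with $L(c)$. -/
theorem mul_half {c d : E} (hc : c * c = c) (hcd : c * d = 0) (x : E) :
    c * (d * (c * x)) = (2⁻¹ : ℝ) • (d * (c * x)) := by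
  have h1 : c * ((2 : ℝ) • (c * (c * x)) - c * x) = (2 : ℝ) • (c * (c * x)) - c * x := by
    have := peirce_polynomial hc x
    rw [mul_sub, mul_smul_comm]
    linear_combination (norm := module) this
  have h2 := mul_eq_zero_of_peirce hc h1 hcd
  rw [mul_comm, mul_sub, mul_smul_comm] at h2
  rw [← mul_left_comm_of_mul_eq_zero hc hcd]
  linear_combination (norm := module) (2⁻¹ : ℝ) • h2

theorem one_ne_zero' [Nontrivial E] : (1 : E) ≠ 0 := by
  intro h
  obtain ⟨x, hx⟩ := exists_ne (0 : E)
  exact hx (by rw [← one_mul' x, h, zero_mul])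

theorem size_pos (hE : IsSimpleEJA E) {n : ℕ} {c : Fin n → E} (hc : IsJordanFrame c) : 0 < n := by
  have := hE.1
  rcases Nat.eq_zero_or_pos n with rfl | h
  · exact absurd hc.sum_eq_one.symm (by simpa using one_ne_zero' (E := E))
  · exact h

end HalfSpace

section Trace

variable {E : Type*} [NormedAddCommGroup E] [InnerProductSpace ℝ E] [EuclideanJordanAlgebra E]
  [FiniteDimensional ℝ E]

/-- Here $a^2=\alpha c+\beta d$, and the Jordan identity $a(a^2a)=a^2a^2$ forces
$\alpha=\beta\neq0$. Associativity of the trace form gives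
$\alpha\,\mathrm{tr}\,L(c)=\tfrac12\mathrm{tr}\,L(a^2)=\beta\,\mathrm{tr}\,L(d)$. -/
theorem mulTrace_eq_of_half {c d a : E} (hc : IsPrimitiveIdempotent c)
    (hd : IsPrimitiveIdempotent d) (hcd : c * d = 0) (ha : a ≠ 0)
    (hca : c * a = (2⁻¹ : ℝ) • a) (hda : d * a = (2⁻¹ : ℝ) • a) : mulTrace c = mulTrace d := by
  have hc1 := hc.1.1
  have hd1 := hd.1.1
  obtain ⟨α, hα⟩ := isPrimitive_peirce_one hc (mul_mul_self_of_half hc1 hca)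
  obtain ⟨β, hβ⟩ := isPrimitive_peirce_one hd (mul_mul_self_of_half hd1 hda)
  have hf : (c + d) * (c + d) = c + d := by
    rw [add_mul, mul_add, mul_add, hc1, hd1, mul_comm d c, hcd]; abel
  have hfa : (c + d) * a = a := by rw [add_mul, hca, hda]; module
  have haa : a * a = α • c + β • d := by
    rw [← hα, ← hβ, ← add_mul, ← mul_left_comm_of_mul_eq_self hf hfa, hfa]
  have hα0 : α ≠ 0 := by
    rintro rfl
    rw [zero_smul] at hα
    have h1 : ⟪c, a * a⟫_ℝ = 2⁻¹ * ⟪a, a⟫_ℝ := by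
      rw [inner_mul', hca, inner_smul_left, conj_trivial]
    rw [← hc1, inner_mul_left, hα, inner_zero_right] at h1
    exact ha (inner_self_eq_zero.1 (by linarith : ⟪a, a⟫_ℝ = 0))
  have hαβ : α = β := by
    have h1 : a * ((a * a) * a) = (a * a) * (a * a) := jordan' a a
    have h2 : (a * a) * a = (2⁻¹ * (α + β)) • a := by
      rw [haa, add_mul, smul_mul_assoc, smul_mul_assoc, hca, hda]; module
    have h3 := congrArg (c * ·) h1
    simp only [h2, mul_smul_comm, hα] at h3
    rw [haa] at h3
    simp only [mul_add, add_mul, mul_smul_comm, smul_mul_assoc, hc1, hd1, hcd, mul_comm d c,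
      smul_zero, add_zero, zero_add] at h3
    have h4 : ((2⁻¹ * (α + β)) * α - α * α) • c = 0 := by
      rw [sub_smul, sub_eq_zero, mul_smul, mul_smul α α, mul_add]; exact h3
    have h5 := (smul_eq_zero.1 h4).resolve_right hc.1.2
    have h6 : α * (β - α) = 0 := by linarith
    linarith [(mul_eq_zero.1 h6).resolve_left hα0]
  have h1 := mulTrace_mul_mul c a a
  have h2 := mulTrace_mul_mul d a a
  rw [hα, hca, smul_mul_assoc, mulTrace_smul, mulTrace_smul] at h1
  rw [hβ, hda, smul_mul_assoc, mulTrace_smul, mulTrace_smul, ← h1, hαβ] at h2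
  exact mul_left_cancel₀ (hαβ ▸ hα0) h2.symm

/-- This compares different frames. The 1-component of $d$ relative to $c$ is $\alpha c$, and that
of $c$ relative to $d$ is $\beta d$. Both scalars are determined by
$|cd|^2=\tfrac12(\alpha+1)\langle c,d\rangle$, so they agree, and taking traces gives
$\alpha\,\mathrm{tr}\,L(c)=\mathrm{tr}\,L(cd)=\beta\,\mathrm{tr}\,L(d)$. -/
theorem mulTrace_eq_of_inner_ne_zero {c d : E} (hc : IsPrimitiveIdempotent c)
    (hd : IsPrimitiveIdempotent d) (hcd : ⟪c, d⟫_ℝ ≠ 0) : mulTrace c = mulTrace d := by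
  have key : ∀ {c d : E}, IsPrimitiveIdempotent c → d * d = d → ⟪c, d⟫_ℝ ≠ 0 →
      ∃ α : ℝ, α ≠ 0 ∧ ⟪c * d, c * d⟫_ℝ = 2⁻¹ * (α + 1) * ⟪c, d⟫_ℝ ∧
        α * mulTrace c = mulTrace (c * d) := by
    intro c d hc hd1 hcd
    have hc1 := hc.1.1
    have hdd : ⟪c * d, d⟫_ℝ = ⟪c, d⟫_ℝ := by rw [← inner_mul', hd1]
    have h1 : c * ((2 : ℝ) • (c * (c * d)) - c * d) = (2 : ℝ) • (c * (c * d)) - c * d := by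
      have := peirce_polynomial hc1 d
      rw [mul_sub, mul_smul_comm]
      linear_combination (norm := module) this
    obtain ⟨α, hα⟩ := isPrimitive_peirce_one hc h1
    have h2 : α * ⟪c, c⟫_ℝ = ⟪c, d⟫_ℝ := by
      have := congrArg (fun y => ⟪c, y⟫_ℝ) hα
      simp only [inner_sub_right, inner_smul_right, inner_mul', hc1] at this
      linarith
    refine ⟨α, ?_, ?_, ?_⟩
    · rintro rfl
      exact hcd (by rw [← h2, zero_mul])
    · have h3 := congrArg (fun y => ⟪y, d⟫_ℝ) hα
      simp only [inner_sub_left, inner_smul_left, conj_trivial, inner_mul_left c (c * d)] at h3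
      rw [hdd] at h3
      linarith
    · have h3 := congrArg mulTrace hα
      rw [mulTrace_sub, mulTrace_smul, mulTrace_smul, mulTrace_mul_mul, hc1] at h3
      linarith
  obtain ⟨α, hα, h1, h2⟩ := key hc hd.1.1 hcd
  obtain ⟨β, -, h3, h4⟩ := key hd hc.1.1 (by rwa [real_inner_comm])
  rw [mul_comm d c] at h3 h4
  rw [h1, real_inner_comm c d] at h3
  have h5 := mul_right_cancel₀ hcd h3
  have h6 : α = β := by linarith
  rw [← h4, ← h6] at h2
  exact mul_left_cancel₀ hα h2

/-- Let $f$ be the sum of the $c_k$ with the trace of $c_i$. Members of different trace share no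
half space, so $f$ has no half space at all and $E$ is the product of its 1- and 0-spaces.
Simplicity excludes this if another trace occurs. -/
theorem mulTrace_frame_eq (hE : IsSimpleEJA E) {n : ℕ} {c : Fin n → E} (hc : IsJordanFrame c)
    (i j : Fin n) : mulTrace (c i) = mulTrace (c j) := by
  classical
  by_contra hij
  set l : Fin n → ℝ := fun k => if mulTrace (c k) = mulTrace (c i) then 1 else 0 with hl
  set f : E := ∑ k, l k • c k with hf
  have hff : f * f = f := by
    rw [hf, hc.sum_mul_sum]
    refine Finset.sum_congr rfl fun k _ => ?_
    simp only [hl]; split_ifs <;> simp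
  have hzero : ∀ k m x, mulTrace (c k) ≠ mulTrace (c m) → c k * (c m * x) = 0 := by
    intro k m x hkm
    by_contra hne
    have hkm' : k ≠ m := fun e => hkm (by rw [e])
    have h1 := hc.orthogonal k m hkm'
    have h2 := hc.orthogonal m k hkm'.symm
    refine hkm (mulTrace_eq_of_half (hc.primitive k) (hc.primitive m) h1 hne ?_
      (mul_half (hc.mul_self m) h2 x))
    rw [mul_left_comm_of_mul_eq_zero (hc.mul_self m) h2]
    exact mul_half (hc.mul_self k) h1 x
  have hproj : ∀ x, f * (f * x) = f * x := by
    intro x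
    have h1 : ∀ k, (1 - f) * (l k • (c k * x)) = 0 := by
      intro k
      by_cases hk : mulTrace (c k) = mulTrace (c i)
      · have h2 : (1 : E) - f = ∑ m, (1 - l m) • c m := by
          simp only [sub_smul, one_smul, Finset.sum_sub_distrib, hc.sum_eq_one, hf]
        rw [h2, Finset.sum_mul]
        refine Finset.sum_eq_zero fun m _ => ?_
        by_cases hm : mulTrace (c m) = mulTrace (c i)
        · simp [hl, hm]
        · rw [smul_mul_assoc, mul_smul_comm, hzero m k x (fun e => hm (e.trans hk)), smul_zero,
            smul_zero]
      · simp [hl, hk]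
    have h3 : (1 - f) * (f * x) = 0 := by
      conv_lhs => rw [hf, Finset.sum_mul, Finset.mul_sum]
      refine Finset.sum_eq_zero fun k _ => ?_
      rw [smul_mul_assoc]; exact h1 k
    rw [sub_mul, one_mul'] at h3
    exact (sub_eq_zero.1 h3).symm
  have hfi : f * c i = c i := by
    rw [mul_comm, hf, hc.mul_sum]; simp [hl]
  have hfj : f * c j = 0 := by
    rw [mul_comm, hf, hc.mul_sum]; simp [hl, Ne.symm hij]
  have hcompl : IsCompl (LinearMap.eqLocus (mulL E f) LinearMap.id) (LinearMap.ker (mulL E f)) := by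
    refine IsCompl.of_le ?_ ?_
    · intro x hx
      have h1 : f * x = x := hx.1
      have h2 : f * x = 0 := hx.2
      rw [Submodule.mem_bot, ← h1, h2]
    · intro x _
      refine Submodule.mem_sup.2 ⟨f * x, hproj x, x - f * x, ?_, by abel⟩
      change f * (x - f * x) = 0
      rw [mul_sub, hproj, sub_self]
  rcases hE.2 _ _ hcompl
    (fun x hx y hy => by
      change f * (x * y) = x * y
      rw [← mul_left_comm_of_mul_eq_self hff hx, show f * y = y from hy])
    (fun x hx y hy => by
      change f * (x * y) = 0
      rw [← mul_left_comm_of_mul_eq_zero hff hx, show f * y = 0 from hy, mul_zero])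
    (fun x hx y hy => mul_eq_zero_of_peirce hff hx hy) with h | h
  · have : c i ∈ (⊥ : Submodule ℝ E) := h ▸ hfi
    exact hc.ne_zero i this
  · have : c j ∈ (⊥ : Submodule ℝ E) := h ▸ hfj
    exact hc.ne_zero j this

theorem size_mul_mulTrace (hE : IsSimpleEJA E) {n : ℕ} {c : Fin n → E} (hc : IsJordanFrame c)
    (j : Fin n) : n * mulTrace (c j) = Module.finrank ℝ E := by
  rw [← mulTrace_one, ← hc.sum_eq_one, mulTrace_sum,
    Finset.sum_congr rfl fun k _ => mulTrace_frame_eq hE hc k j]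
  simp

/-- Size times common trace is $\dim E$ for each frame. Some $c_i$ is not orthogonal to $d_{j_0}$
because the $c_i$ sum to $e$, so the two common traces coincide. -/
theorem size_eq (hE : IsSimpleEJA E) {n m : ℕ} {c : Fin n → E} {d : Fin m → E}
    (hc : IsJordanFrame c) (hd : IsJordanFrame d) : n = m := by
  have := hE.1
  let j0 : Fin m := ⟨0, size_pos hE hd⟩
  obtain ⟨i, hi⟩ : ∃ i, ⟪c i, d j0⟫_ℝ ≠ 0 := by
    by_contra! h
    have h1 : ⟪(1 : E), d j0⟫_ℝ = 0 := by
      rw [← hc.sum_eq_one, sum_inner]; exact Finset.sum_eq_zero fun i _ => h i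
    rw [← hd.mul_self j0, inner_mul', one_mul'] at h1
    exact (hd.inner_self_pos j0).ne' h1
  have h1 := size_mul_mulTrace hE hc i
  have h2 := size_mul_mulTrace hE hd j0
  rw [mulTrace_eq_of_inner_ne_zero (hc.primitive i) (hd.primitive j0) hi] at h1
  have h3 : mulTrace (d j0) ≠ 0 := by
    intro h
    rw [h, mul_zero] at h2
    have : Module.finrank ℝ E ≠ 0 := Module.finrank_pos.ne'
    exact this (by exact_mod_cast h2.symm)
  exact_mod_cast mul_right_cancel₀ h3 (h1.trans h2.symm)

theorem jordanRank_eq (hE : IsSimpleEJA E) {n : ℕ} {c : Fin n → E} (hc : IsJordanFrame c) :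
    jordanRank E = n := by
  obtain ⟨d, hd⟩ := Nat.sInf_mem (s := {n : ℕ | ∃ c : Fin n → E, IsJordanFrame c}) ⟨n, c, hc⟩
  exact size_eq hE hd hc

theorem mulTrace_frame (hE : IsSimpleEJA E) {n : ℕ} {c : Fin n → E} (hc : IsJordanFrame c)
    (j : Fin n) : mulTrace (c j) = dimDivRank E := by
  have hn := size_pos hE hc
  rw [dimDivRank, jordanRank_eq hE hc, ← size_mul_mulTrace hE hc j]
  field_simp

theorem dimDivRank_pos (hE : IsSimpleEJA E) : 0 < dimDivRank E := by
  have := hE.1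
  obtain ⟨n, c, l, hc, -⟩ := exists_isJordanFrame (1 : E)
  rw [dimDivRank, jordanRank_eq hE hc]
  have h1 := size_pos hE hc
  have h2 : 0 < Module.finrank ℝ E := Module.finrank_pos
  positivity

end Trace

/-! ### Exponentials of multiplication operators. -/

section DiagOp

variable {E : Type*} [NormedAddCommGroup E] [InnerProductSpace ℝ E]
  {ι : Type*} [Fintype ι] [DecidableEq ι]

/-- The operator that is diagonal in the orthonormal basis `b` with eigenvalues `θ`. -/
noncomputable def diagOp (b : OrthonormalBasis ι ℝ E) (θ : ι → ℝ) : E →ₗ[ℝ] E :=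
  Matrix.toLin b.toBasis b.toBasis (Matrix.diagonal θ)

theorem diagOp_basis (b : OrthonormalBasis ι ℝ E) (θ : ι → ℝ) (i : ι) :
    diagOp b θ (b i) = θ i • b i := by
  have h := Matrix.toLin_self b.toBasis b.toBasis (Matrix.diagonal θ) i
  rw [Finset.sum_eq_single i] at h
  · simpa [diagOp] using h
  · intro j _ hj
    rw [Matrix.diagonal_apply_ne _ hj, zero_smul]
  · simp

theorem diagOp_apply (b : OrthonormalBasis ι ℝ E) (θ : ι → ℝ) (y : E) :
    diagOp b θ y = ∑ i, (θ i * ⟪b i, y⟫_ℝ) • b i := by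
  conv_lhs => rw [← b.sum_repr' y]
  rw [map_sum]
  exact Finset.sum_congr rfl fun i _ => by rw [map_smul, diagOp_basis, smul_smul, mul_comm]

theorem diagOp_mul (b : OrthonormalBasis ι ℝ E) (θ η : ι → ℝ) (y : E) :
    diagOp b θ (diagOp b η y) = diagOp b (fun i => θ i * η i) y := by
  rw [diagOp_apply b η, diagOp_apply b (fun i => θ i * η i), map_sum]
  refine Finset.sum_congr rfl fun i _ => ?_
  rw [map_smul, diagOp_basis, smul_smul]; congr 1; ring

theorem diagOp_one (b : OrthonormalBasis ι ℝ E) (y : E) : diagOp b (fun _ => 1) y = y := by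
  simp [diagOp_apply, b.sum_repr']

theorem det_diagOp (b : OrthonormalBasis ι ℝ E) (θ : ι → ℝ) :
    LinearMap.det (diagOp b θ) = ∏ i, θ i := by
  rw [diagOp, LinearMap.det_toLin, Matrix.det_diagonal]

theorem trace_diagOp (b : OrthonormalBasis ι ℝ E) (θ : ι → ℝ) :
    LinearMap.trace ℝ E (diagOp b θ) = ∑ i, θ i := by
  rw [LinearMap.trace_eq_matrix_trace ℝ b.toBasis, diagOp, LinearMap.toMatrix_toLin,
    Matrix.trace_diagonal]

theorem diagOp_eq (b : OrthonormalBasis ι ℝ E) (θ : ι → ℝ) {T : E →ₗ[ℝ] E}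
    (h : ∀ i, T (b i) = θ i • b i) : T = diagOp b θ :=
  b.toBasis.ext fun i => by simp [h, diagOp_basis]

end DiagOp

section Exp

variable {E : Type*} [NormedAddCommGroup E] [InnerProductSpace ℝ E] [EuclideanJordanAlgebra E]
  [FiniteDimensional ℝ E]

/-- The resolvent of a multiplication operator preserves the cone of squares. -/
theorem mem_squares_of_sub_smul_mul_mem {a x : E} {s : ℝ} (hs : 0 ≤ s) (hsa : s * ‖mulCLM a‖ < 1)
    (h : x - s • (a * x) ∈ squares E) : x ∈ squares E := by
  obtain ⟨n, c, l, hc, hx⟩ := exists_isJordanFrame x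
  -- Pairing $x-s\,ax$ with $c_j$ gives $l_j(|c_j|^2-s\langle a,c_j\rangle)$, where the second
  -- factor is positive because $s\|L(a)\|<1$.
  have hl : ∀ j, 0 ≤ l j := by
    intro j
    have h1 := inner_squares_nonneg h ⟨c j, (hc.mul_self j).symm⟩
    have h2 : ⟪a * x, c j⟫_ℝ = l j * ⟪a, c j⟫_ℝ := by
      rw [← inner_mul', mul_comm x, hx, hc.mul_sum, inner_smul_right]
    have h3 : ⟪a, c j⟫_ℝ ≤ ‖mulCLM a‖ * ⟪c j, c j⟫_ℝ := by
      rw [← hc.mul_self j, inner_mul', hc.mul_self, real_inner_self_eq_norm_mul_norm, ← mul_assoc]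
      refine (real_inner_le_norm _ _).trans ?_
      gcongr
      exact (mulCLM a).le_opNorm (c j)
    have h4 := hc.inner_self_pos j
    rw [inner_sub_left, inner_smul_left, conj_trivial, h2, hx, hc.inner_sum] at h1
    have h5 : 0 ≤ (⟪c j, c j⟫_ℝ - s * ⟪a, c j⟫_ℝ) * l j := by linarith
    refine nonneg_of_mul_nonneg_right h5 ?_
    nlinarith [mul_le_mul_of_nonneg_left h3 hs]
  rw [hx]
  exact (sum_mem_squares_iff hc).2 hl

variable {ι : Type*} [Fintype ι] [DecidableEq ι]

/-- The exponential of a multiplication operator preserves the cone of squares. -/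
theorem diagOp_exp_mem_squares (b : OrthonormalBasis ι ℝ E) {a : E} {μ : ι → ℝ}
    (h : ∀ i, a * b i = μ i • b i) {y : E} (hy : y ∈ squares E) :
    diagOp b (fun i => Real.exp (μ i)) y ∈ squares E := by
  have hμ : ∀ i, |μ i| ≤ ‖mulCLM a‖ := by
    intro i
    have h1 := (mulCLM a).le_opNorm (b i)
    rw [mulCLM_apply, h, norm_smul, b.norm_eq_one, mul_one, mul_one, Real.norm_eq_abs] at h1
    exact h1
  have hL : mulL E a = diagOp b μ := diagOp_eq b μ h
  -- The exponential is the limit of $(1-L(a)/k)^{-k}$, a power of a resolvent that preserves the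
  -- closed set of squares.
  have hmem : ∀ k : ℕ, ‖mulCLM a‖ < k →
      diagOp b (fun i => (((1 + (-μ i) / k) ^ k)⁻¹)) y ∈ squares E := by
    intro k hk
    have hk0 : (0 : ℝ) < k := (norm_nonneg _).trans_lt hk
    have hne : ∀ i, 1 + (-μ i) / k ≠ 0 := by
      intro i
      have h2 : μ i < k := (le_abs_self _).trans_lt ((hμ i).trans_lt hk)
      have : (1 + (-μ i) / k) = (k - μ i) / k := by field_simp; ring
      rw [this]
      exact (div_pos (by linarith) hk0).ne'
    have hR : ∀ z ∈ squares E, diagOp b (fun i => (1 + (-μ i) / k)⁻¹) z ∈ squares E := by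
      intro z hz
      refine mem_squares_of_sub_smul_mul_mem (a := a) (s := (k : ℝ)⁻¹) (by positivity) ?_ ?_
      · rw [inv_mul_lt_iff₀ hk0]; simpa using hk
      · have h3 : a * diagOp b (fun i => (1 + (-μ i) / k)⁻¹) z =
            diagOp b μ (diagOp b (fun i => (1 + (-μ i) / k)⁻¹) z) := by rw [← hL]; rfl
        convert hz
        rw [h3, diagOp_mul, diagOp_apply, diagOp_apply, Finset.smul_sum, ← Finset.sum_sub_distrib]
        conv_rhs => rw [← b.sum_repr' z]
        refine Finset.sum_congr rfl fun i _ => ?_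
        rw [smul_smul, ← sub_smul]
        congr 1
        linear_combination ⟪b i, z⟫_ℝ * mul_inv_cancel₀ (hne i)
    have hpow : ∀ m : ℕ, diagOp b (fun i => (((1 + (-μ i) / k) ^ m)⁻¹)) y ∈ squares E := by
      intro m
      induction m with
      | zero => simpa [diagOp_one] using hy
      | succ m ih =>
        have := hR _ ih
        rw [diagOp_mul] at this
        simpa only [pow_succ', mul_inv] using this
    exact hpow k
  have hlim : Filter.Tendsto (fun k : ℕ => diagOp b (fun i => (((1 + (-μ i) / k) ^ k)⁻¹)) y)
      Filter.atTop (nhds (diagOp b (fun i => Real.exp (μ i)) y)) := by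
    simp only [diagOp_apply]
    refine tendsto_finsetSum _ fun i _ =>
      Filter.Tendsto.smul_const (Filter.Tendsto.mul_const _ ?_) _
    have := (Real.tendsto_one_add_div_pow_exp (-μ i)).inv₀ (Real.exp_ne_zero _)
    rwa [← Real.exp_neg, neg_neg] at this
  refine isClosed_squares.mem_of_tendsto hlim ?_
  obtain ⟨N, hN⟩ := exists_nat_gt ‖mulCLM a‖
  filter_upwards [Filter.eventually_ge_atTop N] with k hk
  exact hmem k (hN.trans_le (by exact_mod_cast hk))

/-- Every point of the cone is the image of `1` under a cone automorphism with explicit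
determinant. -/
theorem exists_coneAut (hE : IsSimpleEJA E) {n : ℕ} {c : Fin n → E} (hc : IsJordanFrame c)
    {l : Fin n → ℝ} (hl : ∀ j, 0 < l j) :
    ∃ h : E ≃L[ℝ] E, h '' jordanCone E = jordanCone E ∧ h 1 = ∑ j, l j • c j ∧
      LinearMap.det ((h : E →L[ℝ] E) : E →ₗ[ℝ] E) = (∏ j, l j) ^ dimDivRank E := by
  set a : E := ∑ j, Real.log (l j) • c j with ha
  have hT := isSymmetric_mulL a
  set b := hT.eigenvectorBasis rfl with hb
  set μ := hT.eigenvalues rfl with hμ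
  have hab : ∀ i, a * b i = μ i • b i := fun i => hT.apply_eigenvectorBasis rfl i
  have hab' : ∀ i, (-a) * b i = (-μ i) • b i := fun i => by rw [neg_mul, hab, neg_smul]
  set H : E ≃ₗ[ℝ] E := LinearEquiv.ofLinearMap (diagOp b fun i => Real.exp (μ i))
    (diagOp b fun i => Real.exp (-μ i))
    (by ext y; simp [diagOp_mul, ← Real.exp_add, diagOp_one])
    (by ext y; simp [diagOp_mul, ← Real.exp_add, diagOp_one]) with hH
  have hHQ : H.toContinuousLinearEquiv '' squares E = squares E := by
    refine Set.Subset.antisymm ?_ ?_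
    · rintro _ ⟨y, hy, rfl⟩
      exact diagOp_exp_mem_squares b hab hy
    · intro y hy
      exact ⟨_, diagOp_exp_mem_squares b hab' hy, H.apply_symm_apply y⟩
  refine ⟨H.toContinuousLinearEquiv, ?_, ?_, ?_⟩
  · have := H.toContinuousLinearEquiv.toHomeomorph.image_interior (squares E)
    exact this.trans (congrArg interior hHQ)
  · change diagOp b (fun i => Real.exp (μ i)) 1 = _
    rw [← hc.sum_eq_one, map_sum]
    refine Finset.sum_congr rfl fun j _ => ?_
    have hac : a * c j = Real.log (l j) • c j := by rw [mul_comm, ha, hc.mul_sum]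
    rw [diagOp_apply]
    conv_rhs => rw [← b.sum_repr' (c j), Finset.smul_sum]
    refine Finset.sum_congr rfl fun i _ => ?_
    rw [smul_smul]
    congr 1
    -- Both vectors are eigenvectors of the symmetric $L(a)$, so they are orthogonal unless
    -- $\mu_i=\log l_j$.
    by_cases hi : ⟪b i, c j⟫_ℝ = 0
    · rw [hi, mul_zero, mul_zero]
    · have h1 := inner_mul_left a (b i) (c j)
      rw [hab, hac, inner_smul_left, inner_smul_right, conj_trivial] at h1
      rw [mul_right_cancel₀ hi h1, Real.exp_log (hl j)]
  · change LinearMap.det (diagOp b fun i => Real.exp (μ i)) = _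
    have h1 : ∑ i, μ i = dimDivRank E * ∑ j, Real.log (l j) := by
      rw [← trace_diagOp b, ← diagOp_eq b μ (T := mulL E a) hab]
      change mulTrace a = _
      rw [ha, mulTrace_sum, Finset.mul_sum]
      exact Finset.sum_congr rfl fun j _ => by rw [mulTrace_smul, mulTrace_frame hE hc, mul_comm]
    rw [det_diagOp, ← Real.exp_sum, h1, Real.rpow_def_of_pos (Finset.prod_pos fun j _ => hl j),
      Real.log_prod fun j _ => (hl j).ne', mul_comm]

end Exp

/-! ### Determinants of cone automorphisms. -/

section Interval

variable {E : Type*} [NormedAddCommGroup E] [InnerProductSpace ℝ E] [EuclideanJordanAlgebra E]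

theorem isOpen_jordanInterval : IsOpen (jordanInterval E) :=
  isOpen_jordanCone.inter (isOpen_jordanCone.preimage (continuous_const.sub continuous_id))

theorem smul_mem_jordanCone {t : ℝ} (ht : 0 < t) {x : E} (hx : x ∈ jordanCone E) :
    t • x ∈ jordanCone E := by
  have h1 : (Homeomorph.smulOfNeZero t ht.ne') '' jordanCone E ⊆ squares E := by
    rintro _ ⟨z, hz, rfl⟩
    obtain ⟨y, rfl⟩ := jordanCone_subset_squares hz
    refine ⟨√t • y, ?_⟩
    rw [smul_mul_assoc, mul_smul_comm, smul_smul, Real.mul_self_sqrt ht.le]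
    rfl
  exact interior_maximal h1 ((Homeomorph.smulOfNeZero t ht.ne').isOpenMap _ isOpen_interior)
    ⟨x, hx, rfl⟩

variable [FiniteDimensional ℝ E]

theorem half_mem_jordanInterval : (2⁻¹ : ℝ) • (1 : E) ∈ jordanInterval E := by
  have h := smul_mem_jordanCone (E := E) (t := 2⁻¹) (by norm_num) one_mem_jordanCone
  refine ⟨h, ?_⟩
  convert h using 1
  module

theorem norm_le_of_mem_jordanInterval {x : E} (hx : x ∈ jordanInterval E) : ‖x‖ ≤ ‖(1 : E)‖ := by
  have h1 := inner_squares_nonneg (jordanCone_subset_squares hx.1) (jordanCone_subset_squares hx.2)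
  rw [inner_sub_right, real_inner_self_eq_norm_mul_norm] at h1
  have h2 := real_inner_le_norm x 1
  by_contra! h
  nlinarith [norm_nonneg x, norm_nonneg (1 : E)]

variable [MeasurableSpace E] [BorelSpace E]

theorem volume_jordanInterval_ne_zero : volume (jordanInterval E) ≠ 0 :=
  (isOpen_jordanInterval.measure_pos volume ⟨_, half_mem_jordanInterval⟩).ne'

theorem volume_jordanInterval_ne_top : volume (jordanInterval E) ≠ ∞ := by
  refine ((measure_mono fun x hx => ?_).trans_lt
    (measure_closedBall_lt_top (x := (0 : E)) (r := ‖(1 : E)‖))).ne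
  simpa using norm_le_of_mem_jordanInterval hx

/-- Such a map sends $\mathcal D$ onto itself, and $\mathcal D$ has positive finite volume. -/
theorem abs_det_eq_one {k : E ≃L[ℝ] E} (hk : k '' jordanCone E = jordanCone E) (h1 : k 1 = 1) :
    |LinearMap.det ((k : E →L[ℝ] E) : E →ₗ[ℝ] E)| = 1 := by
  have hmem : ∀ x, k x ∈ jordanCone E ↔ x ∈ jordanCone E := by
    intro x
    conv_lhs => rw [← hk]
    exact k.injective.mem_set_image
  have hD : k '' jordanInterval E = jordanInterval E := by
    have hpre : ∀ x, k x ∈ jordanInterval E ↔ x ∈ jordanInterval E := by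
      intro x
      change (_ ∧ _) ↔ (_ ∧ _)
      rw [hmem, ← hmem (1 - x), map_sub, h1]
    ext x
    constructor
    · rintro ⟨y, hy, rfl⟩; exact (hpre y).2 hy
    · intro hx
      exact ⟨k.symm x, (hpre _).1 (by simpa using hx), by simp⟩
  have h2 := Measure.addHaar_image_continuousLinearEquiv volume k (jordanInterval E)
  rw [hD] at h2
  have h3 : ENNReal.ofReal |LinearMap.det ((k : E →L[ℝ] E) : E →ₗ[ℝ] E)| = 1 := by
    have := (ENNReal.mul_eq_right volume_jordanInterval_ne_zero
      volume_jordanInterval_ne_top).1 h2.symm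
    exact this
  rwa [ENNReal.ofReal_eq_one] at h3

end Interval

section Det

variable {E : Type*} [NormedAddCommGroup E] [InnerProductSpace ℝ E] [EuclideanJordanAlgebra E]
  [FiniteDimensional ℝ E]

theorem jordanDet_spec (x : E) : IsEigenvalueProduct x (jordanDet x) := by
  have h : ∃ d : ℝ, IsEigenvalueProduct x d := by
    obtain ⟨n, c, l, hc, hx⟩ := exists_isJordanFrame x
    exact ⟨_, n, c, l, hc, hx, rfl⟩
  rw [jordanDet, dif_pos h]
  exact h.choose_spec

theorem jordanDet_pos {x : E} (hx : x ∈ jordanCone E) : 0 < jordanDet x := by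
  obtain ⟨n, c, l, hc, hxl, hd⟩ := jordanDet_spec x
  rw [hd]
  exact Finset.prod_pos fun j _ => pos_of_sum_mem_jordanCone hc (hxl ▸ hx) j

variable [MeasurableSpace E] [BorelSpace E]

/-- The determinant of a cone automorphism in terms of its value at the neutral element. -/
theorem abs_det_eq (hE : IsSimpleEJA E) {g : E ≃L[ℝ] E} (hg : g '' jordanCone E = jordanCone E) :
    |LinearMap.det ((g : E →L[ℝ] E) : E →ₗ[ℝ] E)| = jordanDet (g 1) ^ dimDivRank E := by
  have hx : g 1 ∈ jordanCone E := hg ▸ Set.mem_image_of_mem g one_mem_jordanCone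
  obtain ⟨n, c, l, hc, hxl, hd⟩ := jordanDet_spec (g 1)
  have hl : ∀ j, 0 < l j := pos_of_sum_mem_jordanCone hc (hxl ▸ hx)
  -- With $he=ge$, the map $h^{-1}g$ fixes $e$, so $g$ and $h$ have the same absolute determinant.
  obtain ⟨h, hh, h1, hdet⟩ := exists_coneAut hE hc hl
  have hk1 : (g.trans h.symm) 1 = 1 := by
    change h.symm (g 1) = 1
    rw [hxl, ← h1, h.symm_apply_apply]
  have hk : (g.trans h.symm) '' jordanCone E = jordanCone E := by
    change (fun x => h.symm (g x)) '' jordanCone E = _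
    rw [← Set.image_image, hg]
    conv_lhs => rw [← hh]
    rw [Set.image_image]
    simp
  have h2 := abs_det_eq_one hk hk1
  have h3 : ((g : E →L[ℝ] E) : E →ₗ[ℝ] E) =
      ((h : E →L[ℝ] E) : E →ₗ[ℝ] E) ∘ₗ ((g.trans h.symm : E →L[ℝ] E) : E →ₗ[ℝ] E) := by
    ext x; simp
  rw [h3, LinearMap.det_comp, abs_mul, h2, mul_one, hdet, hd, abs_of_pos]
  exact Real.rpow_pos_of_pos (Finset.prod_pos fun j _ => hl j) _

/-- Write $y=he$ with $h$ a cone automorphism; multiplicativity of the linear determinant for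
$g\circ h$ gives the claim raised to the power $n/r>0$. -/
theorem jordanDet_map (hE : IsSimpleEJA E) {g : E ≃L[ℝ] E}
    (hg : g '' jordanCone E = jordanCone E) {y : E} (hy : y ∈ jordanCone E) :
    jordanDet (g y) = jordanDet (g 1) * jordanDet y := by
  obtain ⟨n, c, l, hc, hyl⟩ := exists_isJordanFrame y
  obtain ⟨h, hh, h1, -⟩ := exists_coneAut hE hc (pos_of_sum_mem_jordanCone hc (hyl ▸ hy))
  rw [← hyl] at h1
  have hmem : ∀ {k : E ≃L[ℝ] E}, k '' jordanCone E = jordanCone E → k 1 ∈ jordanCone E :=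
    fun hk => hk ▸ Set.mem_image_of_mem _ one_mem_jordanCone
  have hgh : (h.trans g) '' jordanCone E = jordanCone E := by
    change (fun x => g (h x)) '' jordanCone E = _
    rw [← Set.image_image, hh, hg]
  have h2 := abs_det_eq hE hgh
  have h3 : (((h.trans g : E ≃L[ℝ] E) : E →L[ℝ] E) : E →ₗ[ℝ] E) =
      ((g : E →L[ℝ] E) : E →ₗ[ℝ] E) ∘ₗ ((h : E →L[ℝ] E) : E →ₗ[ℝ] E) := rfl
  have h4 : (h.trans g) 1 = g y := by rw [← h1]; rfl
  rw [h3, LinearMap.det_comp, abs_mul, abs_det_eq hE hg, abs_det_eq hE hh, h1, h4,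
    ← Real.mul_rpow (jordanDet_pos (hmem hg)).le (jordanDet_pos hy).le] at h2
  refine ((Real.rpow_left_inj ?_ ?_ (dimDivRank_pos hE).ne').1 h2).symm
  · exact (mul_pos (jordanDet_pos (hmem hg)) (jordanDet_pos hy)).le
  · exact (jordanDet_pos (h4 ▸ hmem hgh)).le

end Det

end EuclideanJordanAlgebra

/-! ### The change of variables. -/

section LinearChange

variable {E : Type*} [NormedAddCommGroup E] [InnerProductSpace ℝ E]

theorem det_continuousLinearEquiv_ne_zero (g : E ≃L[ℝ] E) :
    LinearMap.det ((g : E →L[ℝ] E) : E →ₗ[ℝ] E) ≠ 0 :=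
  (LinearEquiv.isUnit_det' g.toLinearEquiv).ne_zero

/-- The factor by which a linear automorphism scales volume. -/
noncomputable def volumeScale (g : E ≃L[ℝ] E) : ℝ≥0∞ :=
  ENNReal.ofReal |LinearMap.det ((g : E →L[ℝ] E) : E →ₗ[ℝ] E)|

theorem volumeScale_ne_zero (g : E ≃L[ℝ] E) : volumeScale g ≠ 0 :=
  (ENNReal.ofReal_pos.2 (abs_pos.2 (det_continuousLinearEquiv_ne_zero g))).ne'

theorem volumeScale_ne_top (g : E ≃L[ℝ] E) : volumeScale g ≠ ∞ := ENNReal.ofReal_ne_top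

theorem volumeScale_symm_mul (g : E ≃L[ℝ] E) : volumeScale g.symm * volumeScale g = 1 := by
  rw [volumeScale, volumeScale, ← ENNReal.ofReal_mul (abs_nonneg _), ← abs_mul,
    ← LinearMap.det_comp]
  have : ((g.symm : E →L[ℝ] E) : E →ₗ[ℝ] E) ∘ₗ ((g : E →L[ℝ] E) : E →ₗ[ℝ] E) = LinearMap.id := by
    ext x; simp
  rw [this]; simp

theorem volumeScale_symm (g : E ≃L[ℝ] E) : volumeScale g.symm = (volumeScale g)⁻¹ :=
  ENNReal.eq_inv_of_mul_eq_one_left (volumeScale_symm_mul g)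

variable [FiniteDimensional ℝ E] [MeasurableSpace E] [BorelSpace E]

theorem lintegral_sub_continuousLinearEquiv (g : E ≃L[ℝ] E) (e : E) {ψ : E → ℝ≥0∞}
    (hψ : Measurable ψ) : ∫⁻ x, ψ x = ∫⁻ v, ψ (e - g v) * volumeScale g := by
  have hd := det_continuousLinearEquiv_ne_zero g
  have h1 := Measure.map_linearMap_addHaar_eq_smul_addHaar (volume : Measure E) hd
  have h2 : ∫⁻ v, ψ (e - g v) =
      ∫⁻ z, ψ (e - z) ∂(Measure.map ((g : E →L[ℝ] E) : E →ₗ[ℝ] E) volume) := by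
    have hψ' : Measurable fun z => ψ (e - z) := by fun_prop
    exact (lintegral_map hψ' g.continuous.measurable).symm
  rw [lintegral_mul_const' _ _ (volumeScale_ne_top g), h2, h1, lintegral_smul_measure,
    lintegral_sub_left_eq_self ψ e, volumeScale, smul_eq_mul,
    mul_right_comm, ← ENNReal.ofReal_mul (abs_nonneg _), ← abs_mul, inv_mul_cancel₀ hd]
  simp

theorem lintegral_symm_sub (g : E ≃L[ℝ] E) (e : E) {ψ : E → ℝ≥0∞}
    (hψ : Measurable ψ) : ∫⁻ y, ψ y = ∫⁻ u, ψ (g.symm (e - u)) * (volumeScale g)⁻¹ := by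
  rw [lintegral_sub_continuousLinearEquiv g.symm (g.symm e) hψ, volumeScale_symm]
  simp only [map_sub]

end LinearChange

section Transformation

variable {E : Type*} [NormedAddCommGroup E] [InnerProductSpace ℝ E]

/-- The transformation `(x, y) ↦ (u, v)` with `u = e - w x y` and `v = (w' u)⁻¹ (e - x)`. -/
def betaMap (e : E) (w w' : E → E ≃L[ℝ] E) (p : E × E) : E × E :=
  (e - w p.1 p.2, (w' (e - w p.1 p.2)).symm (e - p.1))

theorem betaMap_betaMap (e : E) (w w' : E → E ≃L[ℝ] E) (q : E × E) :
    betaMap e w w' (betaMap e w' w q) = q := by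
  simp [betaMap]

/-- The Jacobian of the inverse of `betaMap e w w'`. -/
noncomputable def betaJacobian (e : E) (w w' : E → E ≃L[ℝ] E) (q : E × E) : ℝ≥0∞ :=
  (volumeScale (w (e - w' q.1 q.2)))⁻¹ * volumeScale (w' q.1)

theorem betaJacobian_ne_zero (e : E) (w w' : E → E ≃L[ℝ] E) (q : E × E) :
    betaJacobian e w w' q ≠ 0 :=
  mul_ne_zero (ENNReal.inv_ne_zero.2 (volumeScale_ne_top _)) (volumeScale_ne_zero _)

variable [MeasurableSpace E]

/-- Joint measurability of a family of linear automorphisms. -/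
structure IsMeasurableFamily (w : E → E ≃L[ℝ] E) : Prop where
  apply : Measurable fun p : E × E => w p.1 p.2
  symm_apply : Measurable fun p : E × E => (w p.1).symm p.2
  scale : Measurable fun x => volumeScale (w x)

variable [FiniteDimensional ℝ E] [BorelSpace E] {w w' : E → E ≃L[ℝ] E}

theorem measurable_betaMap (e : E) (hw : IsMeasurableFamily w) (hw' : IsMeasurableFamily w') :
    Measurable (betaMap e w w') := by
  have h1 : Measurable fun p : E × E => e - w p.1 p.2 := measurable_const.sub hw.apply
  exact h1.prodMk (hw'.symm_apply.comp (h1.prodMk (measurable_const.sub measurable_fst)))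

theorem measurable_betaJacobian (e : E) (hw : IsMeasurableFamily w) (hw' : IsMeasurableFamily w') :
    Measurable (betaJacobian e w w') :=
  (hw.scale.comp (measurable_const.sub hw'.apply)).inv.mul (hw'.scale.comp measurable_fst)

/-- The change of variables formula for `betaMap`, by two applications of Tonelli's theorem. -/
theorem lintegral_betaMap (e : E) (hw : IsMeasurableFamily w) (hw' : IsMeasurableFamily w')
    {φ : E × E → ℝ≥0∞} (hφ : Measurable φ) :
    ∫⁻ p, φ p ∂(volume.prod volume) =
      ∫⁻ q, φ (betaMap e w' w q) * betaJacobian e w w' q ∂(volume.prod volume) := by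
  have hm1 : Measurable fun p : E × E =>
      φ (p.1, (w p.1).symm (e - p.2)) * (volumeScale (w p.1))⁻¹ :=
    (hφ.comp (measurable_fst.prodMk (hw.symm_apply.comp
      (measurable_fst.prodMk (measurable_const.sub measurable_snd))))).mul
      (hw.scale.comp measurable_fst).inv
  have hm2 : Measurable fun q : E × E => φ (betaMap e w' w q) * betaJacobian e w w' q :=
    (hφ.comp (measurable_betaMap e hw' hw)).mul (measurable_betaJacobian e hw hw')
  rw [lintegral_prod _ hφ.aemeasurable, lintegral_prod _ hm2.aemeasurable]
  have h1 : ∀ x : E, ∫⁻ y, φ (x, y) =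
      ∫⁻ u, φ (x, (w x).symm (e - u)) * (volumeScale (w x))⁻¹ := fun x =>
    lintegral_symm_sub (w x) e (hφ.comp measurable_prodMk_left)
  simp_rw [h1]
  -- After $y$ has been replaced by $u$ for fixed $x$, the order is exchanged so that $x$ can be
  -- replaced by $v$ for fixed $u$.
  rw [lintegral_lintegral_swap hm1.aemeasurable]
  refine lintegral_congr fun u => ?_
  refine (lintegral_sub_continuousLinearEquiv (w' u) e (hm1.comp measurable_prodMk_right)).trans
    (lintegral_congr fun v => ?_)
  simp only [betaMap, betaJacobian, Function.comp_apply, mul_assoc]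

theorem map_betaMap_withDensity (e : E) (hw : IsMeasurableFamily w) (hw' : IsMeasurableFamily w')
    {F : E × E → ℝ≥0∞} (hF : Measurable F) :
    Measure.map (betaMap e w w') (((volume : Measure E).prod volume).withDensity F) =
      (volume.prod volume).withDensity
        fun q => F (betaMap e w' w q) * betaJacobian e w w' q := by
  ext s hs
  have hs' := measurable_betaMap e hw hw' hs
  rw [Measure.map_apply (measurable_betaMap e hw hw') hs, withDensity_apply _ hs',
    withDensity_apply _ hs, ← lintegral_indicator hs', ← lintegral_indicator hs,
    lintegral_betaMap e hw hw' (hF.indicator hs')]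
  refine lintegral_congr fun q => ?_
  by_cases hq : q ∈ s
  · rw [Set.indicator_of_mem hq, Set.indicator_of_mem]
    rwa [Set.mem_preimage, betaMap_betaMap]
  · rw [Set.indicator_of_notMem hq, Set.indicator_of_notMem, zero_mul]
    rwa [Set.mem_preimage, betaMap_betaMap]

/-- Densities are known only almost everywhere; this lets such identities be pulled back along the
map. It holds because the Jacobian never vanishes. -/
theorem quasiMeasurePreserving_betaMap (e : E) (hw : IsMeasurableFamily w)
    (hw' : IsMeasurableFamily w') :
    Measure.QuasiMeasurePreserving (betaMap e w' w)
      ((volume : Measure E).prod volume) (volume.prod volume) := by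
  have hm := measurable_betaMap e hw' hw
  refine ⟨hm, Measure.AbsolutelyContinuous.mk fun s hs h0 => ?_⟩
  rw [Measure.map_apply hm hs]
  have h1 := lintegral_betaMap e hw hw' (φ := s.indicator 1) (measurable_one.indicator hs)
  have hm2 : Measurable fun q : E × E =>
      (s.indicator 1 : E × E → ℝ≥0∞) (betaMap e w' w q) * betaJacobian e w w' q :=
    ((measurable_one.indicator hs).comp hm).mul (measurable_betaJacobian e hw hw')
  rw [lintegral_indicator_one hs, h0, eq_comm, lintegral_eq_zero_iff hm2] at h1
  refine measure_mono_null ?_ (ae_iff.1 h1)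
  intro q hq
  have hq' : betaMap e w' w q ∈ s := hq
  simpa [betaJacobian_ne_zero] using hq'

end Transformation

/-! ### Product densities and independence. -/

section Factorization

variable {α β : Type*} [MeasurableSpace α] [MeasurableSpace β] {μ : Measure α} {ν : Measure β}

/-- A measurable function that is almost everywhere a product of functions of one variable is
almost everywhere a product of measurable functions of one variable. -/
theorem exists_measurable_factors [SFinite μ] [SFinite ν] {k : α × β → ℝ≥0∞} (hk : Measurable k)
    {a : α → ℝ≥0∞} {b : β → ℝ≥0∞} (ha : ∀ u, a u ≠ ∞) (hb : ∀ v, b v ≠ ∞)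
    (h : k =ᵐ[μ.prod ν] fun q => a q.1 * b q.2) (h0 : ∫⁻ q, k q ∂(μ.prod ν) ≠ 0) :
    ∃ (a' : α → ℝ≥0∞) (b' : β → ℝ≥0∞), Measurable a' ∧ Measurable b' ∧
      k =ᵐ[μ.prod ν] fun q => a' q.1 * b' q.2 := by
  have h1 : ∀ᵐ u ∂μ, ∀ᵐ v ∂ν, k (u, v) = a u * b v := Measure.ae_ae_of_ae_prod h
  have h2 : ∀ᵐ v ∂ν, ∀ᵐ u ∂μ, k (u, v) = a u * b v := by
    have := (Measure.measurePreserving_swap (μ := ν) (ν := μ)).quasiMeasurePreserving.ae h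
    exact Measure.ae_ae_of_ae_prod this
  -- Slices of $k$ at a good point are measurable and proportional to the factors. Without a good
  -- point with nonzero factor the integral of $k$ would vanish.
  obtain ⟨u₀, hu, hu0⟩ : ∃ u, (∀ᵐ v ∂ν, k (u, v) = a u * b v) ∧ a u ≠ 0 := by
    by_contra! hcon
    apply h0
    rw [lintegral_prod _ hk.aemeasurable, lintegral_eq_zero_iff hk.lintegral_prod_right']
    filter_upwards [h1] with u hu
    rw [lintegral_congr_ae hu, hcon u hu]; simp
  obtain ⟨v₀, hv, hv0⟩ : ∃ v, (∀ᵐ u ∂μ, k (u, v) = a u * b v) ∧ b v ≠ 0 := by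
    by_contra! hcon
    apply h0
    rw [lintegral_prod_symm _ hk.aemeasurable, lintegral_eq_zero_iff hk.lintegral_prod_left']
    filter_upwards [h2] with v hv
    rw [lintegral_congr_ae hv, hcon v hv]; simp
  have ha' : ∀ᵐ u ∂μ, k (u, v₀) * (b v₀)⁻¹ = a u := by
    filter_upwards [hv] with u hu
    rw [hu, mul_assoc, ENNReal.mul_inv_cancel hv0 (hb v₀), mul_one]
  have hb' : ∀ᵐ v ∂ν, k (u₀, v) * (a u₀)⁻¹ = b v := by
    filter_upwards [hu] with v hv
    rw [hv, mul_comm (a u₀), mul_assoc, ENNReal.mul_inv_cancel hu0 (ha u₀), mul_one]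
  refine ⟨fun u => k (u, v₀) * (b v₀)⁻¹, fun v => k (u₀, v) * (a u₀)⁻¹,
    (hk.comp measurable_prodMk_right).mul_const _, (hk.comp measurable_prodMk_left).mul_const _, ?_⟩
  filter_upwards [h, Measure.quasiMeasurePreserving_fst.ae ha',
    Measure.quasiMeasurePreserving_snd.ae hb'] with q hq hqa hqb
  rw [hq, hqa, hqb]

/-- The factors need not be probability measures; their total masses multiply to 1. -/
theorem indepFun_of_map_eq_prod [SFinite ν] {Ω : Type*} [MeasurableSpace Ω] {P : Measure Ω}
    [IsProbabilityMeasure P] {U : Ω → α} {V : Ω → β}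
    (hUV : AEMeasurable (fun ω => (U ω, V ω)) P)
    (h : Measure.map (fun ω => (U ω, V ω)) P = μ.prod ν) : IndepFun U V P := by
  have hrect : ∀ s t, MeasurableSet s → MeasurableSet t →
      P (U ⁻¹' s ∩ V ⁻¹' t) = μ s * ν t := by
    intro s t hs ht
    rw [← Measure.prod_prod, ← h, Measure.map_apply_of_aemeasurable hUV (hs.prod ht)]
    rfl
  have h1 : μ Set.univ * ν Set.univ = 1 := by
    rw [← hrect _ _ .univ .univ]; simp
  rw [indepFun_iff_measure_inter_preimage_eq_mul]
  intro s t hs ht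
  have hs1 := hrect s Set.univ hs .univ
  have ht1 := hrect Set.univ t .univ ht
  simp only [Set.preimage_univ, Set.inter_univ, Set.univ_inter] at hs1 ht1
  calc P (U ⁻¹' s ∩ V ⁻¹' t) = μ s * ν t * (μ Set.univ * ν Set.univ) := by
        rw [hrect s t hs ht, h1, mul_one]
    _ = P (U ⁻¹' s) * P (V ⁻¹' t) := by rw [hs1, ht1]; ring

end Factorization

namespace EuclideanJordanAlgebra

attribute [local instance] toRing smulCommClass isScalarTower

/-! ### Multiplication algorithms and transport of the densities. -/

section Algorithms

variable {E : Type*} [NormedAddCommGroup E] [InnerProductSpace ℝ E] [EuclideanJordanAlgebra E]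
  {w w' : E → E ≃L[ℝ] E}

theorem _root_.IsMultiplicationAlgorithm.apply_one (hw : IsMultiplicationAlgorithm w) {x : E}
    (hx : x ∈ jordanCone E) : w x 1 = x := (hw x hx).2

theorem _root_.IsMultiplicationAlgorithm.image_cone (hw : IsMultiplicationAlgorithm w) {x : E}
    (hx : x ∈ jordanCone E) : w x '' jordanCone E = jordanCone E := by
  obtain ⟨a, ha, ha'⟩ := connectedComponentIn_subset _ _ (hw x hx).1
  have : a = w x := ContinuousLinearEquiv.coe_injective ha
  rwa [← this]

theorem _root_.IsMultiplicationAlgorithm.apply_mem (hw : IsMultiplicationAlgorithm w) {x y : E}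
    (hx : x ∈ jordanCone E) (hy : y ∈ jordanCone E) : w x y ∈ jordanCone E := by
  rw [← hw.image_cone hx]
  exact Set.mem_image_of_mem _ hy

theorem _root_.IsMultiplicationAlgorithm.symm_mem (hw : IsMultiplicationAlgorithm w) {x y : E}
    (hx : x ∈ jordanCone E) (hy : y ∈ jordanCone E) : (w x).symm y ∈ jordanCone E := by
  rw [← hw.image_cone hx] at hy
  obtain ⟨z, hz, rfl⟩ := hy
  simpa using hz

open Classical in
/-- The family `w`, with the identity as value outside the cone. -/
noncomputable def coneExtend (w : E → E ≃L[ℝ] E) (x : E) : E ≃L[ℝ] E :=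
  if x ∈ jordanCone E then w x else ContinuousLinearEquiv.refl ℝ E

theorem coneExtend_of_mem {x : E} (hx : x ∈ jordanCone E) : coneExtend w x = w x := if_pos hx

theorem coneExtend_of_notMem {x : E} (hx : x ∉ jordanCone E) :
    coneExtend w x = ContinuousLinearEquiv.refl ℝ E := if_neg hx

theorem isMultiplicationAlgorithm_coneExtend (hw : IsMultiplicationAlgorithm w) :
    IsMultiplicationAlgorithm (coneExtend w) := fun x hx => by
  rw [coneExtend_of_mem hx]; exact hw x hx

theorem _root_.IsMultiplicativeFor.pos {f : E → ℝ} (hf : IsMultiplicativeFor w f) {x : E}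
    (hx : x ∈ jordanCone E) : 0 < f x := by
  obtain ⟨l, -, hl⟩ := hf
  rw [hl x hx]; exact Real.exp_pos _

variable [FiniteDimensional ℝ E]

theorem _root_.IsMultiplicativeFor.map_mul {f : E → ℝ} (hf : IsMultiplicativeFor w f)
    (hw : IsMultiplicationAlgorithm w) {x y : E} (hx : x ∈ jordanCone E) (hy : y ∈ jordanCone E) :
    f x * f (w 1 y) = f (w x y) := by
  obtain ⟨l, hlog, hl⟩ := hf
  rw [hl x hx, hl _ (hw.apply_mem one_mem_jordanCone hy), hl _ (hw.apply_mem hx hy),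
    ← Real.exp_add, hlog x hx y hy]

/-- The relevant points are images of cone points: $e-u=w(x)y$, $u=(e-x)+w(x)(e-y)$ and $\tilde
w(u)(e-v)=w(x)(e-y)$. -/
theorem betaMap_mem (hw : IsMultiplicationAlgorithm w) (hw' : IsMultiplicationAlgorithm w')
    {p : E × E} (hx : p.1 ∈ jordanInterval E) (hy : p.2 ∈ jordanInterval E) :
    (betaMap 1 w w' p).1 ∈ jordanInterval E ∧ (betaMap 1 w w' p).2 ∈ jordanInterval E := by
  obtain ⟨x, y⟩ := p
  change x ∈ jordanInterval E at hx
  change y ∈ jordanInterval E at hy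
  have h1 : w x y ∈ jordanCone E := hw.apply_mem hx.1 hy.1
  have h2 : x - w x y ∈ jordanCone E := by
    have := hw.apply_mem hx.1 hy.2
    rwa [map_sub, hw.apply_one hx.1] at this
  have hu : 1 - w x y ∈ jordanCone E := by
    have := add_mem_jordanCone hx.2 h2
    rwa [sub_add_sub_cancel] at this
  refine ⟨⟨hu, ?_⟩, hw'.symm_mem hu hx.2, ?_⟩
  · change 1 - (1 - w x y) ∈ _
    rwa [sub_sub_cancel]
  · change 1 - (w' (1 - w x y)).symm (1 - x) ∈ _
    have h3 : (w' (1 - w x y)).symm (1 - w x y) = 1 := by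
      rw [ContinuousLinearEquiv.symm_apply_eq, hw'.apply_one hu]
    have h4 : 1 - (w' (1 - w x y)).symm (1 - x) =
        (w' (1 - w x y)).symm (1 - w x y) - (w' (1 - w x y)).symm (1 - x) := by rw [h3]
    rw [h4, ← map_sub]
    refine hw'.symm_mem hu ?_
    convert h2 using 1
    abel

theorem betaMap_mem_iff (hw : IsMultiplicationAlgorithm w) (hw' : IsMultiplicationAlgorithm w')
    (q : E × E) :
    ((betaMap 1 w' w q).1 ∈ jordanInterval E ∧ (betaMap 1 w' w q).2 ∈ jordanInterval E) ↔
      (q.1 ∈ jordanInterval E ∧ q.2 ∈ jordanInterval E) := by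
  refine ⟨fun h => ?_, fun h => betaMap_mem hw' hw h.1 h.2⟩
  have := betaMap_mem hw hw' h.1 h.2
  rwa [betaMap_betaMap] at this

theorem firstDensity_nonneg {i f h : E → ℝ} (hi : IsMultiplicativeFor w i)
    (hf : IsMultiplicativeFor w' f) (hh : IsMultiplicativeFor w h) (x : E) :
    0 ≤ firstDensity i f h x := by
  refine Set.indicator_nonneg (fun x hx => ?_) x
  have h1 := jordanDet_pos hx.1
  have h2 := hi.pos hx.1
  have h3 := hh.pos hx.1
  have h4 := hf.pos hx.2
  positivity

theorem secondDensity_nonneg {i h : E → ℝ} (hw : IsMultiplicationAlgorithm w)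
    (hi : ∀ x ∈ jordanCone E, 0 < i x) (hh : ∀ x ∈ jordanCone E, 0 < h x) (x : E) :
    0 ≤ secondDensity w i h x := by
  refine Set.indicator_nonneg (fun x hx => ?_) x
  have h1 : w 1 (1 - x) ∈ jordanCone E := hw.apply_mem one_mem_jordanCone hx.2
  rw [map_sub, hw.apply_one one_mem_jordanCone] at h1
  exact (mul_pos (hh _ (hw.apply_mem one_mem_jordanCone hx.1)) (hi _ h1)).le

variable [MeasurableSpace E] [BorelSpace E]

theorem isMeasurableFamily_coneExtend (hw : IsDifferentiableAlgorithm w) :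
    IsMeasurableFamily (coneExtend w) := by
  classical
  have hc : ContinuousOn (fun x => (w x : E →L[ℝ] E)) (jordanCone E) := hw.continuousOn
  have hc' : ContinuousOn (fun x => ((w x).symm : E →L[ℝ] E)) (jordanCone E) := by
    intro x hx
    have h1 : ContinuousAt ContinuousLinearMap.inverse (w x : E →L[ℝ] E) :=
      (contDiffAt_map_inverse (𝕜 := ℝ) (n := 0) (w x)).continuousAt
    have h2 := ContinuousAt.comp_continuousWithinAt (f := fun x => (w x : E →L[ℝ] E)) h1 (hc x hx)
    simpa [Function.comp_def] using h2
  have hV : MeasurableSet (jordanCone E) := isOpen_jordanCone.measurableSet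
  have hV2 : MeasurableSet (Prod.fst ⁻¹' jordanCone E : Set (E × E)) := measurable_fst hV
  have happ : ∀ g : E → E →L[ℝ] E, ContinuousOn g (jordanCone E) →
      ContinuousOn (fun p : E × E => g p.1 p.2) (Prod.fst ⁻¹' jordanCone E) := fun g hg =>
    (hg.comp continuous_fst.continuousOn fun p hp => hp).clm_apply continuous_snd.continuousOn
  refine ⟨?_, ?_, ?_⟩
  · convert (happ _ hc).measurable_piecewise (continuous_snd (X := E) (Y := E)).continuousOn hV2
      using 1
    funext p
    by_cases hp : p.1 ∈ jordanCone E
    · simp [coneExtend_of_mem hp, Set.piecewise, hp]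
    · simp [coneExtend_of_notMem hp, Set.piecewise, hp]
  · convert (happ _ hc').measurable_piecewise (continuous_snd (X := E) (Y := E)).continuousOn hV2
      using 1
    funext p
    by_cases hp : p.1 ∈ jordanCone E
    · simp [coneExtend_of_mem hp, Set.piecewise, hp]
    · simp [coneExtend_of_notMem hp, Set.piecewise, hp]
  · have hdet : ContinuousOn (fun x => volumeScale (w x)) (jordanCone E) :=
      (ENNReal.continuous_ofReal.comp
        (ContinuousLinearMap.continuous_det (𝕜 := ℝ) (E := E)).abs).comp_continuousOn hc
    convert hdet.measurable_piecewise
      (continuousOn_const (c := volumeScale (ContinuousLinearEquiv.refl ℝ E))) hV using 1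
    funext x
    by_cases hx : x ∈ jordanCone E
    · rw [coneExtend_of_mem hx, Set.piecewise_eq_of_mem _ _ _ hx]
    · rw [coneExtend_of_notMem hx, Set.piecewise_eq_of_notMem _ _ _ hx]

theorem volumeScale_eq (hE : IsSimpleEJA E) (hw : IsMultiplicationAlgorithm w) {x : E}
    (hx : x ∈ jordanCone E) :
    volumeScale (w x) = ENNReal.ofReal (jordanDet x ^ dimDivRank E) := by
  rw [volumeScale, abs_det_eq hE (hw.image_cone hx), hw.apply_one hx]

/-- The product of the densities of `X` and `Y` is carried by the transformation to the product
of densities of the same form. -/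
theorem density_mul_betaJacobian (hE : IsSimpleEJA E) (hw : IsMultiplicationAlgorithm w)
    (hw' : IsMultiplicationAlgorithm w') {i f h : E → ℝ}
    (hi : IsMultiplicativeFor w i) (hi' : IsMultiplicativeFor w' i)
    (hf : IsMultiplicativeFor w' f) (hh : IsMultiplicativeFor w h) (q : E × E) :
    ENNReal.ofReal (firstDensity i f h (betaMap 1 w' w q).1) *
        ENNReal.ofReal (secondDensity w i h (betaMap 1 w' w q).2) * betaJacobian 1 w w' q =
      ENNReal.ofReal (firstDensity i h f q.1) * ENNReal.ofReal (secondDensity w' i f q.2) := by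
  have hiff := betaMap_mem_iff hw hw' q
  by_cases hq : q.1 ∈ jordanInterval E ∧ q.2 ∈ jordanInterval E
  · obtain ⟨hx, hy⟩ := hiff.2 hq
    obtain ⟨hu, hv⟩ := hq
    have h1V := one_mem_jordanCone (E := E)
    obtain ⟨u, v⟩ := q
    change u ∈ jordanInterval E at hu
    change v ∈ jordanInterval E at hv
    set x := (betaMap 1 w' w (u, v)).1 with hxdef
    set y := (betaMap 1 w' w (u, v)).2 with hydef
    have hx1 : 1 - x = w' u v := by simp [hxdef, betaMap]
    have hy1 : w x y = 1 - u := by simp [hxdef, hydef, betaMap]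
    -- This ratio cancels the factor $(\det x)^{n/r}$ of the first input density and supplies $(\det
    -- u)^{n/r}$ to the first output density.
    have hJ : betaJacobian 1 w w' (u, v) =
        ENNReal.ofReal (jordanDet u ^ dimDivRank E / jordanDet x ^ dimDivRank E) := by
      have hpos := Real.rpow_pos_of_pos (jordanDet_pos hx.1) (dimDivRank E)
      rw [ENNReal.ofReal_div_of_pos hpos, ← volumeScale_eq hE hw hx.1,
        ← volumeScale_eq hE hw' hu.1, div_eq_mul_inv, mul_comm]
      rfl
    have hF : 0 ≤ firstDensity i f h x := firstDensity_nonneg hi hf hh x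
    have hG : 0 ≤ secondDensity w i h y :=
      secondDensity_nonneg hw (fun _ => hi.pos) (fun _ => hh.pos) y
    have hF' : 0 ≤ firstDensity i h f u := firstDensity_nonneg hi' hh hf u
    rw [hJ, ← ENNReal.ofReal_mul hF, ← ENNReal.ofReal_mul (mul_nonneg hF hG),
      ← ENNReal.ofReal_mul hF']
    congr 1
    simp only [firstDensity, secondDensity, Set.indicator_of_mem hx, Set.indicator_of_mem hy,
      Set.indicator_of_mem hu, Set.indicator_of_mem hv]
    have e1 : f (1 - x) = f u * f (w' 1 v) := by rw [hx1, hf.map_mul hw' hu.1 hv.1]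
    have e2 : h x * h (w 1 y) = h (1 - u) := by rw [hh.map_mul hw hx.1 hy.1, hy1]
    -- Multiplicativity for $w$ gives $i(w(x)(e-y))$ on the left and for $\tilde w$ gives $i(\tilde
    -- w(u)(e-v))$ on the right; both arguments equal $x+u-e$.
    have e3 : i x * i (1 - w 1 y) = i u * i (1 - w' 1 v) := by
      have a1 := hi.map_mul hw hx.1 hy.2
      have a2 := hi'.map_mul hw' hu.1 hv.2
      rw [map_sub, map_sub, hw.apply_one h1V, hw.apply_one hx.1, hy1] at a1
      rw [map_sub, map_sub, hw'.apply_one h1V, hw'.apply_one hu.1, ← hx1] at a2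
      rw [a1, a2]
      congr 1
      abel
    have hd := (Real.rpow_pos_of_pos (jordanDet_pos hx.1) (dimDivRank E)).ne'
    rw [e1]
    calc _ = jordanDet u ^ dimDivRank E * (i x * i (1 - w 1 y)) * (h x * h (w 1 y)) *
          (f u * f (w' 1 v)) := by field_simp
      _ = _ := by rw [e2, e3]; ring
  · have hl : ENNReal.ofReal (firstDensity i f h (betaMap 1 w' w q).1) *
        ENNReal.ofReal (secondDensity w i h (betaMap 1 w' w q).2) = 0 := by
      rcases not_and_or.1 (hiff.not.2 hq) with h | h
      · simp [firstDensity, Set.indicator_of_notMem h]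
      · simp [secondDensity, Set.indicator_of_notMem h]
    rw [hl, zero_mul]
    rcases not_and_or.1 hq with h | h
    · simp [firstDensity, Set.indicator_of_notMem h]
    · simp [secondDensity, Set.indicator_of_notMem h]

end Algorithms

/-! ### Powers of the determinant. -/

section DetPowers

variable {E : Type*} [NormedAddCommGroup E] [InnerProductSpace ℝ E] [EuclideanJordanAlgebra E]
  [FiniteDimensional ℝ E] {w w' : E → E ≃L[ℝ] E}

theorem isMultiplicativeFor_coneExtend {f : E → ℝ} (hf : IsMultiplicativeFor w f) :
    IsMultiplicativeFor (coneExtend w) f := by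
  obtain ⟨l, hlog, hl⟩ := hf
  refine ⟨l, fun x hx y hy => ?_, hl⟩
  rw [coneExtend_of_mem hx, coneExtend_of_mem one_mem_jordanCone]
  exact hlog x hx y hy

theorem secondDensity_coneExtend (i h : E → ℝ) :
    secondDensity (coneExtend w) i h = secondDensity w i h := by
  simp only [secondDensity, coneExtend_of_mem one_mem_jordanCone]

/-- Since $X$ and $U$ stay in the cone, the algorithms may be replaced by their extensions, which
are measurable on all of $E$. -/
theorem betaUV_eq {Ω : Type*} {X Y : Ω → E} (hw : IsMultiplicationAlgorithm w)
    (hw' : IsMultiplicationAlgorithm w')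
    (hX : ∀ a, X a ∈ jordanInterval E) (hY : ∀ a, Y a ∈ jordanInterval E) :
    (fun a => (betaU w X Y a, betaV w w' X Y a)) =
      fun a => betaMap 1 (coneExtend w) (coneExtend w') (X a, Y a) := by
  funext a
  have hu := (betaMap_mem hw hw' (p := (X a, Y a)) (hX a) (hY a)).1.1
  change 1 - w (X a) (Y a) ∈ jordanCone E at hu
  simp only [betaMap, betaU, betaV, coneExtend_of_mem (hX a).1, coneExtend_of_mem hu]

theorem ofReal_firstDensity_detPower (p₁ p₂ p₃ : ℝ) (x : E) :
    ENNReal.ofReal (firstDensity (detPower p₁) (detPower p₂) (detPower p₃) x) =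
      betaKernel (p₁ + p₃) p₂ x := by
  by_cases hx : x ∈ jordanInterval E
  · simp only [firstDensity, betaKernel, Set.indicator_of_mem hx, detPower]
    rw [← Real.rpow_add (jordanDet_pos hx.1), ← Real.rpow_add (jordanDet_pos hx.1)]
    ring_nf
  · simp [firstDensity, betaKernel, Set.indicator_of_notMem hx]

variable [MeasurableSpace E] [BorelSpace E]

theorem jordanDet_one (hE : IsSimpleEJA E) : jordanDet (1 : E) = 1 := by
  have h := jordanDet_map hE (g := ContinuousLinearEquiv.refl ℝ E) (by simp) one_mem_jordanCone
  have h0 := jordanDet_pos (one_mem_jordanCone (E := E))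
  simp only [ContinuousLinearEquiv.coe_refl', id_eq] at h
  exact (mul_eq_left₀ h0.ne').1 h.symm

theorem jordanDet_algorithm (hE : IsSimpleEJA E) (hw : IsMultiplicationAlgorithm w) {x y : E}
    (hx : x ∈ jordanCone E) (hy : y ∈ jordanCone E) :
    jordanDet (w x y) = jordanDet x * jordanDet y := by
  rw [jordanDet_map hE (hw.image_cone hx) hy, hw.apply_one hx]

theorem jordanDet_algorithm_one (hE : IsSimpleEJA E) (hw : IsMultiplicationAlgorithm w) {y : E}
    (hy : y ∈ jordanCone E) : jordanDet (w 1 y) = jordanDet y := by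
  rw [jordanDet_algorithm hE hw one_mem_jordanCone hy, jordanDet_one hE, one_mul]

theorem isMultiplicativeFor_detPower (hE : IsSimpleEJA E) (hw : IsMultiplicationAlgorithm w)
    (p : ℝ) : IsMultiplicativeFor w (detPower p : E → ℝ) := by
  refine ⟨fun x => Real.log (jordanDet x) * (p - dimDivRank E), fun x hx y hy => ?_,
    fun x hx => Real.rpow_def_of_pos (jordanDet_pos hx) _⟩
  beta_reduce
  rw [jordanDet_algorithm_one hE hw hy, jordanDet_algorithm hE hw hx hy,
    Real.log_mul (jordanDet_pos hx).ne' (jordanDet_pos hy).ne', add_mul]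

theorem ofReal_secondDensity_detPower (hE : IsSimpleEJA E) (hw : IsMultiplicationAlgorithm w)
    (p₁ p₃ : ℝ) (x : E) :
    ENNReal.ofReal (secondDensity w (detPower p₁) (detPower p₃) x) = betaKernel p₃ p₁ x := by
  by_cases hx : x ∈ jordanInterval E
  · simp only [secondDensity, betaKernel, Set.indicator_of_mem hx, detPower]
    have h1 : 1 - w 1 x = w 1 (1 - x) := by rw [map_sub, hw.apply_one one_mem_jordanCone]
    rw [h1, jordanDet_algorithm_one hE hw hx.1, jordanDet_algorithm_one hE hw hx.2]
  · simp [secondDensity, betaKernel, Set.indicator_of_notMem hx]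

theorem measurable_betaKernel (hE : IsSimpleEJA E) (hw : IsMultiplicationAlgorithm w)
    (hwd : IsDifferentiableAlgorithm w) (p q : ℝ) : Measurable (betaKernel p q : E → ℝ≥0∞) := by
  -- Measurability of $\det$ on the cone comes from the algorithm: $\det
  -- x=|\mathrm{Det}\,w(x)|^{r/n}$.
  set m : E → ℝ := fun x => (volumeScale (coneExtend w x)).toReal ^ (dimDivRank E)⁻¹ with hm
  have hmeas : Measurable m :=
    (isMeasurableFamily_coneExtend hwd).scale.ennreal_toReal.pow_const _
  have hdet : ∀ x ∈ jordanCone E, jordanDet x = m x := by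
    intro x hx
    have h0 := (jordanDet_pos hx).le
    rw [hm]
    simp only
    rw [coneExtend_of_mem hx, volumeScale_eq hE hw hx,
      ENNReal.toReal_ofReal (Real.rpow_nonneg h0 _), ← Real.rpow_mul h0,
      mul_inv_cancel₀ (dimDivRank_pos hE).ne', Real.rpow_one]
  have heq : (betaKernel p q : E → ℝ≥0∞) = (jordanInterval E).indicator fun x =>
      ENNReal.ofReal (m x ^ (p - dimDivRank E) * m (1 - x) ^ (q - dimDivRank E)) :=
    Set.indicator_congr fun x hx => by rw [hdet _ hx.1, hdet _ hx.2]
  rw [heq]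
  refine Measurable.indicator ?_ isOpen_jordanInterval.measurableSet
  exact ((hmeas.pow_const _).mul
    ((hmeas.comp (measurable_const.sub measurable_id)).pow_const _)).ennreal_ofReal

end DetPowers

/-! ### Laws of the transformed variables. -/

section Laws

variable {E : Type*} [NormedAddCommGroup E] [InnerProductSpace ℝ E] [FiniteDimensional ℝ E]
  [MeasurableSpace E] [BorelSpace E] [EuclideanJordanAlgebra E] {w w' : E → E ≃L[ℝ] E}
  {Ω : Type*} [MeasurableSpace Ω] {P : Measure Ω} [IsProbabilityMeasure P] {X Y : Ω → E}

/-- Independence of `U` and `V`. -/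
theorem indepFun_betaUV (hE : IsSimpleEJA E)
    (hw : IsMultiplicationAlgorithm w) (hw' : IsMultiplicationAlgorithm w')
    (hwd : IsDifferentiableAlgorithm w) (hwd' : IsDifferentiableAlgorithm w')
    (hX : ∀ a, X a ∈ jordanInterval E) (hY : ∀ a, Y a ∈ jordanInterval E)
    {i f h : E → ℝ} {cX cY : ℝ}
    (hi : IsMultiplicativeFor w i) (hi' : IsMultiplicativeFor w' i)
    (hf : IsMultiplicativeFor w' f) (hh : IsMultiplicativeFor w h) (hXY : IndepFun X Y P)
    (hdX : HasDensity P X (fun x => cX * firstDensity i f h x))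
    (hdY : HasDensity P Y (fun x => cY * secondDensity w i h x)) :
    IndepFun (betaU w X Y) (betaV w w' X Y) P := by
  obtain ⟨hpX, hpX'⟩ := hdX
  obtain ⟨hpY, hpY'⟩ := hdY
  have hmX := HasPDF.aemeasurable X P volume
  have hmY := HasPDF.aemeasurable Y P volume
  have hW := isMeasurableFamily_coneExtend hwd
  have hW' := isMeasurableFamily_coneExtend hwd'
  set Ψ := betaMap 1 (coneExtend w') (coneExtend w) with hΨ
  set F : E × E → ℝ≥0∞ := fun p => pdf X P volume p.1 * pdf Y P volume p.2 with hF
  have hFm : Measurable F := ((measurable_pdf X P volume).comp measurable_fst).mul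
    ((measurable_pdf Y P volume).comp measurable_snd)
  have hlaw : Measure.map (fun a => (X a, Y a)) P = (volume.prod volume).withDensity F := by
    rw [(indepFun_iff_map_prod_eq_prod_map_map hmX hmY).1 hXY, map_eq_withDensity_pdf X P volume,
      map_eq_withDensity_pdf Y P volume,
      prod_withDensity (measurable_pdf X P volume) (measurable_pdf Y P volume)]
  have hUVm : AEMeasurable (fun a => (betaU w X Y a, betaV w w' X Y a)) P := by
    rw [betaUV_eq hw hw' hX hY]
    exact (measurable_betaMap 1 hW hW').comp_aemeasurable (hmX.prodMk hmY)
  set k : E × E → ℝ≥0∞ :=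
    fun q => F (Ψ q) * betaJacobian 1 (coneExtend w) (coneExtend w') q with hk
  have hkm : Measurable k :=
    (hFm.comp (measurable_betaMap 1 hW' hW)).mul (measurable_betaJacobian 1 hW hW')
  have hlawUV : Measure.map (fun a => (betaU w X Y a, betaV w w' X Y a)) P =
      (volume.prod volume).withDensity k := by
    rw [betaUV_eq hw hw' hX hY, ← map_betaMap_withDensity 1 hW hW' hFm, ← hlaw,
      AEMeasurable.map_map_of_aemeasurable (measurable_betaMap 1 hW hW').aemeasurable
        (hmX.prodMk hmY)]
    rfl
  have hk1 : ∫⁻ q, k q ∂(volume.prod volume) = 1 := by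
    have := congrArg (fun μ => μ Set.univ) hlawUV
    simp only [withDensity_apply _ MeasurableSet.univ, Measure.restrict_univ] at this
    rw [← this, Measure.map_apply_of_aemeasurable hUVm .univ]
    simp
  have hFae : F =ᵐ[volume.prod volume] fun p => ENNReal.ofReal (cX * firstDensity i f h p.1) *
      ENNReal.ofReal (cY * secondDensity w i h p.2) := by
    filter_upwards [Measure.quasiMeasurePreserving_fst.ae hpX',
      Measure.quasiMeasurePreserving_snd.ae hpY'] with p h1 h2
    rw [hF]
    simp only
    rw [h1, h2]
  have hkae : k =ᵐ[volume.prod volume] fun q =>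
      (ENNReal.ofReal cX * ENNReal.ofReal cY * ENNReal.ofReal (firstDensity i h f q.1)) *
        ENNReal.ofReal (secondDensity w' i f q.2) := by
    filter_upwards [(quasiMeasurePreserving_betaMap 1 hW hW').ae hFae] with q hq
    have hd := density_mul_betaJacobian hE (isMultiplicationAlgorithm_coneExtend hw)
      (isMultiplicationAlgorithm_coneExtend hw') (isMultiplicativeFor_coneExtend hi)
      (isMultiplicativeFor_coneExtend hi') (isMultiplicativeFor_coneExtend hf)
      (isMultiplicativeFor_coneExtend hh) q
    rw [secondDensity_coneExtend, secondDensity_coneExtend] at hd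
    rw [mul_assoc, ← hd, hk]
    simp only
    rw [hΨ, hq, ENNReal.ofReal_mul' (firstDensity_nonneg hi hf hh _),
      ENNReal.ofReal_mul' (secondDensity_nonneg hw (fun _ => hi.pos) (fun _ => hh.pos) _)]
    ring
  -- The functions $i,f,h$ carry no measurability assumption, so the factors of the density are
  -- replaced by measurable ones.
  obtain ⟨a, b, ha, hb, hab⟩ := exists_measurable_factors hkm
    (fun u => ENNReal.mul_ne_top (ENNReal.mul_ne_top ENNReal.ofReal_ne_top ENNReal.ofReal_ne_top)
      ENNReal.ofReal_ne_top)
    (fun v => ENNReal.ofReal_ne_top) hkae (by rw [hk1]; exact one_ne_zero)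
  refine indepFun_of_map_eq_prod (μ := volume.withDensity a) (ν := volume.withDensity b) hUVm ?_
  rw [hlawUV, withDensity_congr_ae hab, prod_withDensity ha hb]

theorem map_eq_jordanBeta {p q c : ℝ} {φ : E → ℝ} (hφ : ∀ x, 0 ≤ φ x)
    (hm : Measurable (betaKernel p q : E → ℝ≥0∞))
    (hφk : ∀ x, ENNReal.ofReal (φ x) = betaKernel p q x)
    (hd : HasDensity P X (fun x => c * φ x)) : Measure.map X P = jordanBeta E p q := by
  obtain ⟨hpX, hpX'⟩ := hd
  have hmX := HasPDF.aemeasurable X P volume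
  have h1 : Measure.map X P =
      ENNReal.ofReal c • (volume : Measure E).withDensity (betaKernel p q) := by
    rw [map_eq_withDensity_pdf X P volume, withDensity_congr_ae hpX', ← withDensity_smul _ hm]
    congr 1
    funext x
    rw [ENNReal.ofReal_mul' (hφ x), hφk]; rfl
  have h2 : ENNReal.ofReal c * ∫⁻ x : E, betaKernel p q x = 1 := by
    have := congrArg (fun μ => μ Set.univ) h1
    simp only [Measure.smul_apply, withDensity_apply _ MeasurableSet.univ, Measure.restrict_univ,
      smul_eq_mul] at this
    rw [← this, Measure.map_apply_of_aemeasurable hmX .univ]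
    simp
  rw [h1, jordanBeta, ENNReal.eq_inv_of_mul_eq_one_left h2]

theorem jordanBeta_prod (p q p' q' : ℝ) (hm : Measurable (betaKernel p q : E → ℝ≥0∞))
    (hm' : Measurable (betaKernel p' q' : E → ℝ≥0∞)) :
    (jordanBeta E p q).prod (jordanBeta E p' q') =
      ((∫⁻ x : E, betaKernel p q x)⁻¹ * (∫⁻ x : E, betaKernel p' q' x)⁻¹) •
        (volume.prod volume).withDensity
          fun x : E × E => betaKernel p q x.1 * betaKernel p' q' x.2 := by
  rw [jordanBeta, jordanBeta, Measure.prod_smul_left, Measure.prod_smul_right, smul_smul,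
    prod_withDensity hm hm']

/-- Beta inputs are transformed into beta outputs. -/
theorem hasLaw_betaUV (hE : IsSimpleEJA E)
    (hw : IsMultiplicationAlgorithm w) (hw' : IsMultiplicationAlgorithm w')
    (hwd : IsDifferentiableAlgorithm w) (hwd' : IsDifferentiableAlgorithm w')
    (hX : ∀ a, X a ∈ jordanInterval E) (hY : ∀ a, Y a ∈ jordanInterval E) {p₁ p₂ p₃ : ℝ}
    (h : HasLaw (fun a => (X a, Y a))
      ((jordanBeta E (p₁ + p₃) p₂).prod (jordanBeta E p₃ p₁)) P) :
    HasLaw (fun a => (betaU w X Y a, betaV w w' X Y a))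
      ((jordanBeta E (p₁ + p₂) p₃).prod (jordanBeta E p₂ p₁)) P := by
  have hW := isMeasurableFamily_coneExtend hwd
  have hW' := isMeasurableFamily_coneExtend hwd'
  have hB := measurable_betaKernel hE hw hwd
  have hUVm : AEMeasurable (fun a => (betaU w X Y a, betaV w w' X Y a)) P := by
    rw [betaUV_eq hw hw' hX hY]
    exact (measurable_betaMap 1 hW hW').comp_aemeasurable h.aemeasurable
  refine ⟨hUVm, ?_⟩
  set c := (∫⁻ x : E, betaKernel (p₁ + p₃) p₂ x)⁻¹ * (∫⁻ x : E, betaKernel p₃ p₁ x)⁻¹ with hc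
  have hFm : Measurable fun x : E × E => betaKernel (p₁ + p₃) p₂ x.1 * betaKernel p₃ p₁ x.2 :=
    ((hB _ _).comp measurable_fst).mul ((hB _ _).comp measurable_snd)
  have hdens : ∀ q : E × E,
      betaKernel (p₁ + p₃) p₂ (betaMap 1 (coneExtend w') (coneExtend w) q).1 *
        betaKernel p₃ p₁ (betaMap 1 (coneExtend w') (coneExtend w) q).2 *
        betaJacobian 1 (coneExtend w) (coneExtend w') q =
      betaKernel (p₁ + p₂) p₃ q.1 * betaKernel p₂ p₁ q.2 := by
    intro q
    have hcw := isMultiplicationAlgorithm_coneExtend hw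
    have hcw' := isMultiplicationAlgorithm_coneExtend hw'
    have hd := density_mul_betaJacobian hE hcw hcw'
      (isMultiplicativeFor_detPower hE hcw p₁) (isMultiplicativeFor_detPower hE hcw' p₁)
      (isMultiplicativeFor_detPower hE hcw' p₂) (isMultiplicativeFor_detPower hE hcw p₃) q
    rwa [ofReal_firstDensity_detPower, ofReal_firstDensity_detPower,
      ofReal_secondDensity_detPower hE hcw, ofReal_secondDensity_detPower hE hcw'] at hd
  have hlaw : Measure.map (fun a => (betaU w X Y a, betaV w w' X Y a)) P =
      c • (volume.prod volume).withDensity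
        fun x : E × E => betaKernel (p₁ + p₂) p₃ x.1 * betaKernel p₂ p₁ x.2 := by
    rw [betaUV_eq hw hw' hX hY]
    have h1 := AEMeasurable.map_map_of_aemeasurable (μ := P)
      (measurable_betaMap (1 : E) hW hW').aemeasurable h.aemeasurable
    rw [Function.comp_def] at h1
    rw [← h1, h.map_eq, jordanBeta_prod _ _ _ _ (hB _ _) (hB _ _), Measure.map_smul,
      map_betaMap_withDensity 1 hW hW' hFm]
    simp_rw [hdens, hc]
  -- The image law has total mass 1, which identifies the normalizing constant without evaluating a
  -- beta integral.
  have hmass : c * ((∫⁻ x : E, betaKernel (p₁ + p₂) p₃ x) * ∫⁻ x : E, betaKernel p₂ p₁ x) = 1 := by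
    have := congrArg (fun μ => μ Set.univ) hlaw
    simp only [Measure.smul_apply, withDensity_apply _ MeasurableSet.univ, Measure.restrict_univ,
      smul_eq_mul, lintegral_prod_mul (hB (p₁ + p₂) p₃).aemeasurable
        (hB p₂ p₁).aemeasurable] at this
    rw [← this, Measure.map_apply_of_aemeasurable hUVm .univ]
    simp
  set Z₁ := ∫⁻ x : E, betaKernel (p₁ + p₂) p₃ x with hZ₁
  set Z₂ := ∫⁻ x : E, betaKernel p₂ p₁ x with hZ₂
  have hZ₁0 : Z₁ ≠ 0 := fun e => by simp [e] at hmass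
  have hZ₂0 : Z₂ ≠ 0 := fun e => by simp [e] at hmass
  rw [hlaw, jordanBeta_prod _ _ _ _ (hB _ _) (hB _ _), ENNReal.eq_inv_of_mul_eq_one_left hmass,
    ENNReal.mul_inv (Or.inl hZ₁0) (Or.inr hZ₂0)]

end Laws

end EuclideanJordanAlgebra

open EuclideanJordanAlgebra in
theorem mainTheorem4 {E : Type*} [NormedAddCommGroup E] [InnerProductSpace ℝ E]
    [FiniteDimensional ℝ E] [MeasurableSpace E] [BorelSpace E] [EuclideanJordanAlgebra E]
    (hE : IsSimpleEJA E)
    (w w' : E → E ≃L[ℝ] E)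
    (hw : IsMultiplicationAlgorithm w) (hw' : IsMultiplicationAlgorithm w')
    (hwd : IsDifferentiableAlgorithm w) (hwd' : IsDifferentiableAlgorithm w')
    {Ω : Type*} [MeasurableSpace Ω] (P : Measure Ω) [IsProbabilityMeasure P]
    (X Y : Ω → E) (hX : ∀ a, X a ∈ jordanInterval E) (hY : ∀ a, Y a ∈ jordanInterval E) :
    -- the general result
    (∀ (i f h : E → ℝ) (cX cY : ℝ),
      IsMultiplicativeFor w i → IsMultiplicativeFor w' i →
      IsMultiplicativeFor w' f → IsMultiplicativeFor w h →
      IndepFun X Y P →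
      HasDensity P X (fun x => cX * firstDensity i f h x) →
      HasDensity P Y (fun x => cY * secondDensity w i h x) →
      IndepFun (betaU w X Y) (betaV w w' X Y) P) ∧
    -- the beta case
    (∀ p₁ p₂ p₃ : ℝ, dimDivRank E - 1 < p₁ → dimDivRank E - 1 < p₂ → dimDivRank E - 1 < p₃ →
      -- powers of the determinant are admissible choices of `i`, `f`, `h` ...
      (IsMultiplicativeFor w (detPower p₁ : E → ℝ) ∧
        IsMultiplicativeFor w' (detPower p₁ : E → ℝ) ∧
        IsMultiplicativeFor w' (detPower p₂ : E → ℝ) ∧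
        IsMultiplicativeFor w (detPower p₃ : E → ℝ)) ∧
      -- ... for which the densities above are those of beta laws ...
      (∀ cX cY : ℝ, IndepFun X Y P →
        HasDensity P X (fun x => cX * firstDensity (detPower p₁) (detPower p₂) (detPower p₃) x) →
        HasDensity P Y (fun x => cY * secondDensity w (detPower p₁) (detPower p₃) x) →
        HasLaw (fun a => (X a, Y a))
          ((jordanBeta E (p₁ + p₃) p₂).prod (jordanBeta E p₃ p₁)) P) ∧
      -- ... and beta inputs are transformed into beta outputs
      (HasLaw (fun a => (X a, Y a))
          ((jordanBeta E (p₁ + p₃) p₂).prod (jordanBeta E p₃ p₁)) P →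
        HasLaw (fun a => (betaU w X Y a, betaV w w' X Y a))
          ((jordanBeta E (p₁ + p₂) p₃).prod (jordanBeta E p₂ p₁)) P)) := by
  refine ⟨fun i f h cX cY hi hi' hf hh hXY hdX hdY =>
    indepFun_betaUV hE hw hw' hwd hwd' hX hY hi hi' hf hh hXY hdX hdY, fun p₁ p₂ p₃ _ _ _ => ?_⟩
  have h1 := isMultiplicativeFor_detPower hE hw p₁
  have h1' := isMultiplicativeFor_detPower hE hw' p₁
  have h2 := isMultiplicativeFor_detPower hE hw' p₂
  have h3 := isMultiplicativeFor_detPower hE hw p₃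
  refine ⟨⟨h1, h1', h2, h3⟩, fun cX cY hXY hdX hdY => ?_,
    fun h => hasLaw_betaUV hE hw hw' hwd hwd' hX hY h⟩
  have hB := measurable_betaKernel hE hw hwd
  have hmX := hdX.1.aemeasurable'
  have hmY := hdY.1.aemeasurable'
  refine ⟨hmX.prodMk hmY, ?_⟩
  rw [(indepFun_iff_map_prod_eq_prod_map_map hmX hmY).1 hXY,
    map_eq_jordanBeta (firstDensity_nonneg h1 h2 h3) (hB _ _)
      (ofReal_firstDensity_detPower p₁ p₂ p₃) hdX,
    map_eq_jordanBeta (secondDensity_nonneg hw (fun _ => h1.pos) (fun _ => h3.pos)) (hB _ _)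
      (ofReal_secondDensity_detPower hE hw p₁ p₃) hdY]
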